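/- **Setting (non-clairvoyant scheduling).** Fix a horizon $T\ge 2$, a number $m$ of machines, integers $\ell_{\max},d_{\max}\ge 0$ and a real $v_{\max}\ge 0$. An instance $\mathcal J$ is a finite set of jobs in a fixed arrival order (ties broken arbitrarily); job $j$ has an arrival time $a_j\in\{1,\dots,T\}$, a latest starting time $d_j$ with $a_j\le d_j\le \min(a_j+d_{\max},T)$, an integer length $0\le l_j\le \ell_{\max}$ and a value per unit length $v_j\in[0,v_{\max}]$. A (deterministic) non-clairvoyant online mechanism starts each job $j$ at a time in $[a_j,d_j]$, or rejects it, charges the scheduled jobs, runs a started job without interruption for $l_j$ time units, and never runs more than $m$ jobs at once; its decisions at time $t$ depend only on the jobs arrived by $t$ with their reports $(a_j,d_j,v_j)$, on its own earlier decisions and on the lengths of the jobs completed before time unit $t$; prices are determined by the time the job is completed. Mechanisms are assumed measurable. A randomized mechanism is a (jointly measurable) random choice of such a mechanism. The welfare is $W(A,\mathcal J)=\sum_{t=1}^T W_t(A,\mathcal J)$, where $W_t$ is the sum of $v_j$ over the jobs being processed in time unit $t$. **Restarts.** A restart of $A$ at time $t$ moves the arrival times of the jobs that arrive in $[t,t+\ell_{\max}+d_{\max}]$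 to $t+\ell_{\max}+d_{\max}+1$, keeping their order and their latest starting times (jobs that would arrive after their latest starting time are rejected); the jobs that arrived before $t$ are handled by $A$ as if no further jobs arrived, and the jobs from the restart until the next restart are handled by $A$ from an empty state, as if they were the only jobs. Several restarts are applied in order of time. Given candidate mechanisms $A_1,\dots,A_n$ ($n\ge1$) and $\gamma\in[0,1]$, let $\overline{A_i}$ be $A_i$ with a restart at each time $t\in\{1,\dots,T\}$ independently with probability $\gamma$, and let $$\mathrm{OPT}(\mathcal J)=\max_i W(A_i,\mathcal J),\qquad \overline{\mathrm{OPT}}(\mathcal J)=\max_i \mathbf E\big[W(\overline{A_i},\mathcal J)\big].$$ For a probability distribution $\mathcal D$ on instances, the benchmark with parameter $\gamma$ is *robust-to-welfare-loss* if $$\mathbf E_{\mathcal J\sim\mathcal D}[\overline{\mathrm{OPT}}(\mathcal J)]\ \ge\ \mathbf E_{\mathcal J\sim\mathcal D}[\mathrm{OPT}(\mathcal J)]-\gamma\, T\, v_{\max}(\ell_{\max}+d_{\max}).$$ **Claim.** There is a universal constant $C>0$ such that for all $T\ge2$, $m,\ell_{\max},d_{\max},v_{\max}$ and all candidate mechanisms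 $A_1,\dots,A_n$ there is a randomized non-clairvoyant online mechanism $M$ (not depending on $\mathcal D$) with the following property. Let $\gamma=\min\{1,(\ell_{\max}+d_{\max})^{-2/3}T^{-1/3}(n\log n)^{1/3}\}$ (and $\gamma=0$ if $\ell_{\max}+d_{\max}=0$). For every probability distribution $\mathcal D$ on instances for which the random-restarting benchmark with parameter $\gamma$ is robust-to-welfare-loss, $$\mathbf E_{\mathcal J\sim\mathcal D}[\mathrm{OPT}(\mathcal J)]-\mathbf E_{\mathcal J\sim\mathcal D}\,\mathbf E\big[W(M,\mathcal J)\big]\ \le\ C\,m\,v_{\max}(\ell_{\max}+d_{\max})^{1/3}(n\log n)^{1/3}\,T^{2/3}\log T\ =\ \tilde O(T^{2/3}).$$ -/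

import Mathlib

open MeasureTheory

noncomputable section

namespace Scheduling

/-- The parameters of a scheduling problem: time horizon `T`, number `m` of machines, bounds
`dmax`, `lmax`, `vmax` on the waiting window, the length and the value per unit length of a job. -/
structure Params where
  T : ℕ
  m : ℕ
  dmax : ℕ
  lmax : ℕ
  vmax : ℝ
  vmax_nonneg : 0 ≤ vmax

/-- A job. Non-clairvoyant convention: `deadline` is the latest time at which the job may be
*started*, and `length` is not reported (it is seen only when the job is completed). -/
structure Job where
  arrival : ℕ
  deadline : ℕ
  length : ℕ
  value : ℝ

instance : MeasurableSpace Job :=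
  MeasurableSpace.comap (fun j : Job => (j.arrival, j.deadline, j.length, j.value)) inferInstance

/-- A finite set of jobs, named by natural numbers: the jobs are `job k` for `k ∈ ids`
(the values of `job` off `ids` are meaningless). The order of the names is the arrival order,
including the tie-breaking between jobs that arrive at the same time; see `Instance.Valid`. -/
structure Instance where
  ids : Finset ℕ
  job : ℕ → Job

instance : MeasurableSpace Instance :=
  MeasurableSpace.comap Instance.ids ⊤ ⊔ MeasurableSpace.comap Instance.job inferInstance

structure Instance.Valid (P : Params) (J : Instance) : Prop where
  arrival_mem : ∀ k ∈ J.ids, 1 ≤ (J.job k).arrival ∧ (J.job k).arrival ≤ P.T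
  deadline_mem : ∀ k ∈ J.ids, (J.job k).arrival ≤ (J.job k).deadline ∧
    (J.job k).deadline ≤ (J.job k).arrival + P.dmax
  deadline_le : ∀ k ∈ J.ids, (J.job k).deadline ≤ P.T
  length_le : ∀ k ∈ J.ids, (J.job k).length ≤ P.lmax
  value_mem : ∀ k ∈ J.ids, 0 ≤ (J.job k).value ∧ (J.job k).value ≤ P.vmax
  arrival_mono : ∀ k ∈ J.ids, ∀ k' ∈ J.ids, k < k' → (J.job k).arrival ≤ (J.job k').arrival

/-- A non-preemptive schedule: `σ k = some s` if job `k` is started at time `s` (it then occupies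
one machine during the time units `s, …, s + length - 1`), `σ k = none` if it is rejected. -/
abbrev Schedule := ℕ → Option ℕ

open Classical in
/-- The jobs that are being processed during time unit `t`. -/
def running (σ : Schedule) (J : Instance) (t : ℕ) : Finset ℕ :=
  J.ids.filter fun k => ∃ s, σ k = some s ∧ s ≤ t ∧ t < s + (J.job k).length

/-- The value `W_t` generated during time unit `t`. -/
def welfareAt (σ : Schedule) (J : Instance) (t : ℕ) : ℝ :=
  ∑ k ∈ running σ J t, (J.job k).value

/-- The social welfare `W = ∑_{t = 1}^T W_t`. -/
def welfare (P : Params) (σ : Schedule) (J : Instance) : ℝ :=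
  ∑ t ∈ Finset.Icc 1 P.T, welfareAt σ J t

/-- What a non-clairvoyant online algorithm has seen when it decides which jobs to start at time
`t` is the same for `J` and `J'`: the same jobs have arrived up to time `t`, with the same reports
(arrival, deadline, value); the same jobs were started at the same times before `t`; and the
lengths of those that were completed before time unit `t` are the same. -/
structure SameHistory (start : Instance → Schedule) (t : ℕ) (J J' : Instance) : Prop where
  arrived : ∀ k, (k ∈ J.ids ∧ (J.job k).arrival ≤ t) ↔ (k ∈ J'.ids ∧ (J'.job k).arrival ≤ t)
  reports : ∀ k ∈ J.ids, (J.job k).arrival ≤ t →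
    (J.job k).arrival = (J'.job k).arrival ∧ (J.job k).deadline = (J'.job k).deadline ∧
      (J.job k).value = (J'.job k).value
  started : ∀ k s, s < t → (start J k = some s ↔ start J' k = some s)
  completed : ∀ k s, s < t → start J k = some s →
    (s + (J.job k).length ≤ t ∨ s + (J'.job k).length ≤ t) →
      (J.job k).length = (J'.job k).length

/-- A (deterministic) non-clairvoyant online scheduling mechanism: a schedule and a price per unit
length for every instance, such that
* only jobs of the instance are started, and each of them between its arrival and its deadline;
* at no time are more than `m` jobs being processed;
* which jobs are started at time `t` depends only on what has been seen by then;
* only scheduled jobs are charged, and the price is determined when the job is completed. -/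
structure Mechanism (P : Params) where
  start : Instance → Schedule
  price : Instance → ℕ → ℝ
  start_mem : ∀ J : Instance, J.Valid P → ∀ k s, start J k = some s →
    k ∈ J.ids ∧ (J.job k).arrival ≤ s ∧ s ≤ (J.job k).deadline
  feasible : ∀ J : Instance, J.Valid P → ∀ t, (running (start J) J t).card ≤ P.m
  online : ∀ J J' : Instance, J.Valid P → J'.Valid P → ∀ t, SameHistory start t J J' →
    ∀ k, start J k = some t ↔ start J' k = some t
  price_unscheduled : ∀ J : Instance, J.Valid P → ∀ k, start J k = none → price J k = 0
  price_online : ∀ J J' : Instance, J.Valid P → J'.Valid P → ∀ t, SameHistory start t J J' →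
    ∀ k s, start J k = some s → s < t → s + (J.job k).length ≤ t → price J k = price J' k
  measurable_start : ∀ k s, MeasurableSet {J : Instance | start J k = some s}

/-- A randomized mechanism: a mechanism drawn from its internal coin flips `ω : Ω`. -/
structure RandomizedMechanism (P : Params) where
  Ω : Type
  mΩ : MeasurableSpace Ω
  μ : Measure Ω
  isProb : IsProbabilityMeasure μ
  mech : Ω → Mechanism P
  measurable_start : ∀ k s,
    MeasurableSet {p : Ω × Instance | (mech p.1).start p.2 k = some s}

/-- The expected welfare of a randomized mechanism on an instance. -/
def RandomizedMechanism.expectedWelfare {P : Params} (M : RandomizedMechanism P)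
    (J : Instance) : ℝ :=
  letI := M.mΩ
  ∫ ω, welfare P ((M.mech ω).start J) J ∂M.μ

/-! ### Restarts -/

/-- The arrival time `a` after the restarts at the times `1, …, t` that belong to `S` have been
applied one after the other: a restart at time `r` moves every arrival in `[r, r + L]` to
`r + L + 1`. -/
def shiftedArrival (S : Finset ℕ) (L a : ℕ) : ℕ → ℕ
  | 0 => a
  | t + 1 =>
    if t + 1 ∈ S ∧ t + 1 ≤ shiftedArrival S L a t ∧ shiftedArrival S L a t ≤ t + 1 + L then
      t + 1 + L + 1
    else shiftedArrival S L a t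

/-- The arrival time of job `k` after all restarts in `S`, where `L = lmax + dmax`. -/
def newArrival (P : Params) (S : Finset ℕ) (J : Instance) (k : ℕ) : ℕ :=
  shiftedArrival S (P.lmax + P.dmax) (J.job k).arrival P.T

/-- The last restart at or before time `a` (`0` if there is none). -/
def lastRestart (S : Finset ℕ) (a : ℕ) : ℕ := (S.filter (· ≤ a)).sup id

/-- The jobs handled from the restart `r` on and until the next one (`r = 0`: before the first
restart), with their new arrival times and in the old order. The latest starting time of a job is
unchanged, so the time it is willing to wait shrinks by the time lost; jobs whose new arrival time
exceeds it are rejected. -/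
def block (P : Params) (S : Finset ℕ) (J : Instance) (r : ℕ) : Instance where
  ids := J.ids.filter fun k =>
    newArrival P S J k ≤ (J.job k).deadline ∧ lastRestart S (newArrival P S J k) = r
  job k := { J.job k with arrival := newArrival P S J k }

/-- The schedule of the mechanism `A` restarted at the times in `S`: after each restart, `A`
handles the new jobs from an empty state, i.e. as if they were the only ones, while the jobs that
arrived before are completed (if at all) exactly as `A` would do without further arrivals. -/
def restartSchedule {P : Params} (A : Mechanism P) (S : Finset ℕ) (J : Instance) : Schedule :=
  fun k => A.start (block P S J (lastRestart S (newArrival P S J k))) k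

/-- The expected welfare of the random-restarting mechanism: at each time in `{1, …, T}` there is,
independently, a restart with probability `γ`. -/
def restartWelfare {P : Params} (γ : ℝ) (A : Mechanism P) (J : Instance) : ℝ :=
  ∑ S ∈ (Finset.Icc 1 P.T).powerset,
    γ ^ S.card * (1 - γ) ^ (P.T - S.card) * welfare P (restartSchedule A S J) J

/-- The benchmark: the welfare of the best candidate in hindsight. -/
def OPT {P : Params} {n : ℕ} (A : Fin n → Mechanism P) (J : Instance) : ℝ :=
  ⨆ i, welfare P ((A i).start J) J

/-- The random-restarting benchmark with parameter `γ`. -/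
def restartOPT {P : Params} {n : ℕ} (γ : ℝ) (A : Fin n → Mechanism P) (J : Instance) : ℝ :=
  ⨆ i, restartWelfare γ (A i) J

/-- The random-restarting benchmark with parameter `γ` is robust to welfare loss in expectation
over instances drawn from `D`. -/
def RobustToWelfareLoss {P : Params} {n : ℕ} (γ : ℝ) (A : Fin n → Mechanism P)
    (D : Measure Instance) : Prop :=
  (∫ J, restartOPT γ A J ∂D) ≥
    (∫ J, OPT A J ∂D) - γ * (P.T : ℝ) * (P.vmax * ((P.lmax : ℝ) + (P.dmax : ℝ)))

/-- The restart probability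
`γ = (lmax + dmax) ^ (-2/3) * T ^ (-1/3) * (n log n) ^ (1/3)`, capped at `1`. -/
def restartProb (P : Params) (n : ℕ) : ℝ :=
  min 1 (((P.lmax : ℝ) + (P.dmax : ℝ)) ^ (-(2 / 3) : ℝ) * (P.T : ℝ) ^ (-(1 / 3) : ℝ) *
    ((n : ℝ) * Real.log n) ^ (1 / 3 : ℝ))

end Scheduling

end

/-! Time is cut at random restarts, and EXP3 picks the candidate that handles each block of jobs
between two restarts. Put L = lmax + dmax. A job finishes at most L time units after its (shifted)
arrival, and a restart at `r` removes all arrivals from [r, r + L]. So the jobs of a block are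
finished before the first job of the next block is handled. This separation
(`lastRestart_of_mem_running_block`) has three consequences. Blocks never compete for machines.
Total welfare is the sum of the block welfares (`welfare_composite`). And the welfare of past blocks
is known by the time a later choice matters, although lengths are revealed only on completion
(`SameHistory.blockWelfare_eq`). Since every block starts from an empty state, a candidate's welfare
on it does not depend on earlier choices: for fixed restarts this is a bandit problem against an
oblivious adversary.

With losses bounded by B_r on block r, EXP3 has regret at most log n / η + (η n / 2) ∑ B_r²
(`Bandit.integral_loss_le`), and here B_r = m vmax · (length of block r). The sum of squared lengths
counts pairs of times in the same block. Times at distance d, up to the delay L, are not separated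
with probability (1 - γ)^d, so its expectation is at most 3T / γ when γL ≤ 1
(`expected_blockLength_sq_le`).

This bounds the regret against the restarting benchmark on every instance; robustness then passes to
`OPT` at the price γ T vmax L. For X = L^(1/3) (n log n)^(1/3) T^(2/3), the prescribed γ satisfies
γTL = X and γX² = (n log n) T, so η = log n / (X m vmax) makes every term of order m vmax X. If X is
too large compared with T, the trivial welfare bound m vmax T is enough. The factor log T is slack.
-/

noncomputable section

/-! ### Sampling an arm from a uniform seed. -/

namespace Bandit

variable {n : ℕ}

/-- The cumulative sums of a weight vector. -/
def cumulative (p : Fin n → ℝ) (k : ℕ) : ℝ := ∑ j : Fin n, if j.val < k then p j else 0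

lemma cumulative_zero (p : Fin n → ℝ) : cumulative p 0 = 0 := by simp [cumulative]

lemma cumulative_self (p : Fin n → ℝ) : cumulative p n = ∑ j, p j := by simp [cumulative]

lemma cumulative_succ (p : Fin n → ℝ) (i : Fin n) :
    cumulative p (i.val + 1) = cumulative p i.val + p i := by
  have h : ∀ j : Fin n, (if j.val < i.val + 1 then p j else 0) =
      (if j.val < i.val then p j else 0) + if j = i then p j else 0 := by
    intro j
    rcases lt_trichotomy j.val i.val with h | h | h
    · have : j ≠ i := fun e => by simp [e] at h
      simp [h, this, Nat.lt_succ_of_lt h]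
    · have : j = i := Fin.ext h
      simp [this]
    · have : j ≠ i := fun e => by simp [e] at h
      have h1 : ¬ j.val < i.val + 1 := by omega
      have h2 : ¬ j.val < i.val := by omega
      simp [h1, h2, this]
  simp only [cumulative, h, Finset.sum_add_distrib]
  simp

lemma cumulative_mono {p : Fin n → ℝ} (hp : ∀ i, 0 ≤ p i) : Monotone (cumulative p) := by
  intro a b hab
  refine Finset.sum_le_sum fun j _ => ?_
  split_ifs with h1 h2
  · exact le_rfl
  · omega
  · exact hp j
  · exact le_rfl

lemma cumulative_nonneg {p : Fin n → ℝ} (hp : ∀ i, 0 ≤ p i) (k : ℕ) : 0 ≤ cumulative p k := by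
  simpa [cumulative_zero] using cumulative_mono hp (Nat.zero_le k)

/-- The event that the seed `u` selects the arm `i` under inverse transform sampling. -/
def Selects (p : Fin n → ℝ) (u : ℝ) (i : Fin n) : Prop :=
  cumulative p i.val ≤ u ∧ u < cumulative p (i.val + 1)

lemma Selects.eq {p : Fin n → ℝ} (hp : ∀ i, 0 ≤ p i) {u : ℝ} {i j : Fin n}
    (hi : Selects p u i) (hj : Selects p u j) : i = j := by
  rcases lt_trichotomy i j with h | h | h
  · have := cumulative_mono hp (Nat.succ_le_of_lt h)
    exact absurd (hi.2.trans_le (this.trans hj.1)) (lt_irrefl _)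
  · exact h
  · have := cumulative_mono hp (Nat.succ_le_of_lt h)
    exact absurd (hj.2.trans_le (this.trans hi.1)) (lt_irrefl _)

lemma exists_selects {p : Fin n → ℝ} {u : ℝ} (h0 : 0 ≤ u) (h1 : u < ∑ j, p j) :
    ∃ i, Selects p u i := by
  have key : ∀ k ≤ n, u < cumulative p k → ∃ i, Selects p u i := by
    intro k
    induction k with
    | zero => intro _ h; rw [cumulative_zero] at h; linarith
    | succ k ih =>
      intro hk h
      by_cases h' : u < cumulative p k
      · exact ih (by omega) h'
      · exact ⟨⟨k, by omega⟩, not_lt.1 h', h⟩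
  exact key n le_rfl (by rwa [cumulative_self])

variable [NeZero n]

open Classical in
/-- Inverse transform sampling of an arm from the weights `p` with the seed `u`. -/
def sample (p : Fin n → ℝ) (u : ℝ) : Fin n :=
  if h : ∃ i, Selects p u i then h.choose else 0

lemma sample_eq_of_selects {p : Fin n → ℝ} (hp : ∀ i, 0 ≤ p i) {u : ℝ} {i : Fin n}
    (h : Selects p u i) : sample p u = i := by
  have h' : ∃ i, Selects p u i := ⟨i, h⟩
  rw [sample, dif_pos h']
  exact h'.choose_spec.eq hp h

/-- Removes the choice operator from `sample`, default value included, so that its fibres are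
visibly measurable. -/
lemma sample_eq_iff {p : Fin n → ℝ} (hp : ∀ i, 0 ≤ p i) {u : ℝ} {i : Fin n} :
    sample p u = i ↔ Selects p u i ∨ ((∀ j, ¬ Selects p u j) ∧ i = 0) := by
  by_cases h : ∃ j, Selects p u j
  · obtain ⟨j, hj⟩ := h
    rw [sample_eq_of_selects hp hj]
    constructor
    · rintro rfl; exact Or.inl hj
    · rintro (h | h)
      · exact hj.eq hp h
      · exact absurd hj (h.1 j)
  · rw [sample, dif_neg h]
    push Not at h
    constructor
    · intro e; exact Or.inr ⟨h, e.symm⟩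
    · rintro (h' | h')
      · exact absurd h' (h i)
      · exact h'.2.symm

/-- The uniform distribution on `[0, 1)`. -/
def uniform : Measure ℝ := volume.restrict (Set.Ico 0 1)

instance : IsProbabilityMeasure uniform := ⟨by simp [uniform]⟩

/-- The selection intervals tile [0, 1), and the one of arm `i` has length `p i`. -/
lemma integral_sample {p : Fin n → ℝ} (hp : ∀ i, 0 ≤ p i) (hsum : ∑ i, p i = 1)
    (F : Fin n → ℝ) : ∫ u, F (sample p u) ∂uniform = ∑ i, p i * F i := by
  have h1 : ∀ u ∈ Set.Ico (0 : ℝ) 1, F (sample p u) =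
      ∑ i, (Set.Ico (cumulative p i.val) (cumulative p (i.val + 1))).indicator
        (fun _ => F i) u := by
    intro u hu
    obtain ⟨i, hi⟩ := exists_selects (p := p) hu.1 (by rw [hsum]; exact hu.2)
    rw [sample_eq_of_selects hp hi, Finset.sum_eq_single i]
    · rw [Set.indicator_of_mem]; exact hi
    · intro j _ hj
      rw [Set.indicator_of_notMem]
      intro hju
      exact hj (Selects.eq hp hju hi)
    · simp
  rw [uniform, setIntegral_congr_fun measurableSet_Ico h1, integral_finsetSum]
  · refine Finset.sum_congr rfl fun i _ => ?_
    rw [integral_indicator measurableSet_Ico, Measure.restrict_restrict measurableSet_Ico,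
      Set.inter_eq_left.2, setIntegral_const, Real.volume_real_Ico_of_le, cumulative_succ]
    · simp
    · exact cumulative_mono hp (Nat.le_succ _)
    · refine Set.Ico_subset_Ico (cumulative_nonneg hp _) ?_
      rw [← hsum, ← cumulative_self]
      exact cumulative_mono hp i.2
  · intro i _
    exact (integrable_const _).indicator measurableSet_Ico

/-! ### The EXP3 dynamics. -/

/-- The Gibbs distribution of the cumulative losses `x` at inverse temperature `η`. -/
def gibbs (η : ℝ) (x : Fin n → ℝ) (i : Fin n) : ℝ :=
  Real.exp (-(η * x i)) / ∑ j, Real.exp (-(η * x j))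

lemma sum_exp_pos (η : ℝ) (x : Fin n → ℝ) : 0 < ∑ j, Real.exp (-(η * x j)) :=
  Finset.sum_pos (fun _ _ => Real.exp_pos _) Finset.univ_nonempty

lemma gibbs_pos (η : ℝ) (x : Fin n → ℝ) (i : Fin n) : 0 < gibbs η x i :=
  div_pos (Real.exp_pos _) (sum_exp_pos η x)

lemma sum_gibbs (η : ℝ) (x : Fin n → ℝ) : ∑ i, gibbs η x i = 1 := by
  simp only [gibbs]
  rw [← Finset.sum_div, div_self (sum_exp_pos η x).ne']

/-- Update of the estimated cumulative losses after the arm `i` has suffered the loss `l`: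
the importance weighted loss is added to the coordinate `i`. -/
def step (η : ℝ) (x : Fin n → ℝ) (i : Fin n) (l : ℝ) : Fin n → ℝ :=
  fun j => x j + if j = i then l / gibbs η x i else 0

/-- The estimated cumulative losses in EXP3 with losses `ℓ` and seeds `u`, starting from `x`. -/
def state (η : ℝ) (ℓ : ℕ → Fin n → ℝ) (x : Fin n → ℝ) (u : ℕ → ℝ) : ℕ → Fin n → ℝ
  | 0 => x
  | t + 1 =>
    let y := state η ℓ x u t
    let i := sample (gibbs η y) (u t)
    step η y i (ℓ t i)

/-- The arm that EXP3 pulls in round `t`. -/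
def arm (η : ℝ) (ℓ : ℕ → Fin n → ℝ) (x : Fin n → ℝ) (u : ℕ → ℝ) (t : ℕ) : Fin n :=
  sample (gibbs η (state η ℓ x u t)) (u t)

lemma state_succ (η : ℝ) (ℓ : ℕ → Fin n → ℝ) (x : Fin n → ℝ) (u : ℕ → ℝ) (t : ℕ) :
    state η ℓ x u (t + 1) =
      step η (state η ℓ x u t) (arm η ℓ x u t) (ℓ t (arm η ℓ x u t)) := rfl

/-- Bandit feedback. The losses need only agree in rounds where both runs pull the same arm, and the
induction supplies that equality. This conditional form is what the scheduling application can
verify. -/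
lemma state_eq_of_forall_lt {η : ℝ} {ℓ ℓ' : ℕ → Fin n → ℝ} {x : Fin n → ℝ} {u : ℕ → ℝ} {t : ℕ}
    (h : ∀ s < t, arm η ℓ x u s = arm η ℓ' x u s →
      ℓ s (arm η ℓ x u s) = ℓ' s (arm η ℓ x u s)) :
    state η ℓ x u t = state η ℓ' x u t := by
  induction t with
  | zero => rfl
  | succ t ih =>
    have h1 := ih fun s hs => h s (by omega)
    have h2 : arm η ℓ x u t = arm η ℓ' x u t := by rw [arm, arm, h1]
    rw [state_succ, state_succ, ← h2, h1, h t (by omega) h2]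

/-- EXP3 depends on the losses only through those of the arms pulled in the past. -/
lemma arm_eq_of_forall_lt {η : ℝ} {ℓ ℓ' : ℕ → Fin n → ℝ} {x : Fin n → ℝ} {u : ℕ → ℝ} {t : ℕ}
    (h : ∀ s < t, arm η ℓ x u s = arm η ℓ' x u s →
      ℓ s (arm η ℓ x u s) = ℓ' s (arm η ℓ x u s)) :
    arm η ℓ x u t = arm η ℓ' x u t := by
  rw [arm, arm, state_eq_of_forall_lt h]

/-- Prepend a seed to a sequence of seeds. -/
def seedCons (a : ℝ) (u : ℕ → ℝ) : ℕ → ℝ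
  | 0 => a
  | t + 1 => u t

/-- The Markov property: after one round EXP3 is again EXP3 with shifted losses and a new initial
state. This is why the initial state is kept arbitrary throughout. -/
lemma state_seedCons (η : ℝ) (ℓ : ℕ → Fin n → ℝ) (x : Fin n → ℝ) (a : ℝ) (u : ℕ → ℝ) (t : ℕ) :
    state η ℓ x (seedCons a u) (t + 1) =
      state η (fun s => ℓ (s + 1))
        (step η x (sample (gibbs η x) a) (ℓ 0 (sample (gibbs η x) a))) u t := by
  induction t with
  | zero => rfl
  | succ t ih => rw [state_succ, arm, ih]; rfl

lemma arm_seedCons_succ (η : ℝ) (ℓ : ℕ → Fin n → ℝ) (x : Fin n → ℝ) (a : ℝ) (u : ℕ → ℝ)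
    (t : ℕ) :
    arm η ℓ x (seedCons a u) (t + 1) =
      arm η (fun s => ℓ (s + 1))
        (step η x (sample (gibbs η x) a) (ℓ 0 (sample (gibbs η x) a))) u t := by
  rw [arm, state_seedCons]; rfl

lemma arm_seedCons_zero (η : ℝ) (ℓ : ℕ → Fin n → ℝ) (x : Fin n → ℝ) (a : ℝ) (u : ℕ → ℝ) :
    arm η ℓ x (seedCons a u) 0 = sample (gibbs η x) a := rfl

/-! ### Measurability -/

lemma measurable_sample {α : Type*} [MeasurableSpace α] {p : α → Fin n → ℝ} {u : α → ℝ}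
    (hp : ∀ i, Measurable fun a => p a i) (h0 : ∀ a i, 0 ≤ p a i) (hu : Measurable u) :
    Measurable fun a => sample (p a) (u a) := by
  have hc : ∀ k, Measurable fun a => cumulative (p a) k := by
    intro k
    refine Finset.measurable_sum _ fun j _ => ?_
    split_ifs
    · exact hp j
    · exact measurable_const
  have hs : ∀ i, MeasurableSet {a | Selects (p a) (u a) i} := fun i =>
    (measurableSet_le (hc _) hu).inter (measurableSet_lt hu (hc _))
  refine measurable_to_countable' fun i => ?_
  have : (fun a => sample (p a) (u a)) ⁻¹' {i} =
      {a | Selects (p a) (u a) i} ∪ ((⋂ j, {a | Selects (p a) (u a) j}ᶜ) ∩ {_a | i = 0}) := by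
    ext a
    simp [sample_eq_iff (h0 a)]
  rw [this]
  exact (hs i).union ((MeasurableSet.iInter fun j => (hs j).compl).inter (MeasurableSet.const _))

omit [NeZero n] in
lemma measurable_gibbs {α : Type*} [MeasurableSpace α] {x : α → Fin n → ℝ} (η : ℝ)
    (hx : ∀ i, Measurable fun a => x a i) (i : Fin n) : Measurable fun a => gibbs η (x a) i := by
  have h : ∀ i, Measurable fun a => Real.exp (-(η * x a i)) := fun i =>
    Real.measurable_exp.comp ((hx i).const_mul η).neg
  exact (h i).div (Finset.measurable_sum _ fun j _ => h j)

omit [NeZero n] in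
lemma measurable_eval_arm {α : Type*} [MeasurableSpace α] {f : α → Fin n → ℝ} {i : α → Fin n}
    (hf : ∀ i, Measurable fun a => f a i) (hi : Measurable i) :
    Measurable fun a => f a (i a) := by
  have : (fun a => f a (i a)) = fun a => ∑ j, (i ⁻¹' {j}).indicator (fun a => f a j) a := by
    ext a
    rw [Finset.sum_eq_single (i a)]
    · simp
    · intro j _ hj
      exact Set.indicator_of_notMem (fun h => hj (by simpa using h.symm)) _
    · simp
  rw [this]
  exact Finset.measurable_sum _ fun j _ => (hf j).indicator (hi (measurableSet_singleton j))

lemma measurable_arm_of_state {α : Type*} [MeasurableSpace α] {η : ℝ} {ℓ : α → ℕ → Fin n → ℝ}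
    {x : Fin n → ℝ} {u : α → ℕ → ℝ} {t : ℕ} (hu : Measurable fun a => u a t)
    (h : ∀ i, Measurable fun a => state η (ℓ a) x (u a) t i) :
    Measurable fun a => arm η (ℓ a) x (u a) t :=
  measurable_sample (measurable_gibbs η h) (fun _ _ => (gibbs_pos _ _ _).le) hu

lemma measurable_state {α : Type*} [MeasurableSpace α] {η : ℝ} {ℓ : α → ℕ → Fin n → ℝ}
    {x : Fin n → ℝ} {u : α → ℕ → ℝ} (hℓ : ∀ t i, Measurable fun a => ℓ a t i)
    (hu : ∀ t, Measurable fun a => u a t) (t : ℕ) (i : Fin n) :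
    Measurable fun a => state η (ℓ a) x (u a) t i := by
  induction t generalizing i with
  | zero => exact measurable_const
  | succ t ih =>
    have ha := measurable_arm_of_state (hu t) ih
    simp only [state_succ, step]
    refine (ih i).add (Measurable.ite ?_ ?_ measurable_const)
    · have : {a | i = arm η (ℓ a) x (u a) t} =
          (fun a => arm η (ℓ a) x (u a) t) ⁻¹' {i} := by
        ext a; simp [eq_comm]
      rw [this]
      exact ha (measurableSet_singleton i)
    · exact (measurable_eval_arm (hℓ t) ha).div
        (measurable_eval_arm (measurable_gibbs η ih) ha)

lemma measurable_arm {α : Type*} [MeasurableSpace α] {η : ℝ} {ℓ : α → ℕ → Fin n → ℝ}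
    {x : Fin n → ℝ} {u : α → ℕ → ℝ} (hℓ : ∀ t i, Measurable fun a => ℓ a t i)
    (hu : ∀ t, Measurable fun a => u a t) (t : ℕ) :
    Measurable fun a => arm η (ℓ a) x (u a) t :=
  measurable_arm_of_state (hu t) (measurable_state hℓ hu t)

lemma measurable_seedCons : Measurable fun p : ℝ × (ℕ → ℝ) => seedCons p.1 p.2 := by
  refine measurable_pi_lambda _ fun t => ?_
  cases t with
  | zero => exact measurable_fst
  | succ t => exact (measurable_pi_apply t).comp measurable_snd

/-! ### The regret bound -/

/-- The law of the seeds of `N` rounds: independent and uniform on `[0, 1)`. -/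
def seedLaw : ℕ → Measure (ℕ → ℝ)
  | 0 => Measure.dirac 0
  | N + 1 => (uniform.prod (seedLaw N)).map fun p => seedCons p.1 p.2

instance isProbabilityMeasure_seedLaw (N : ℕ) : IsProbabilityMeasure (seedLaw N) := by
  induction N with
  | zero => exact Measure.dirac.isProbabilityMeasure
  | succ N ih => exact Measure.isProbabilityMeasure_map measurable_seedCons.aemeasurable

/-- Follows from e^y ≥ 1 + y + y²/2 and (1 - y + y²/2)(1 + y + y²/2) = 1 + y⁴/4 ≥ 1. -/
lemma sub_sq_div_two_le_one_sub_exp_neg {y : ℝ} (hy : 0 ≤ y) :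
    y - y ^ 2 / 2 ≤ 1 - Real.exp (-y) := by
  have h : Real.exp (-y) ≤ 1 - y + y ^ 2 / 2 := by
    have hq := Real.quadratic_le_exp_of_nonneg hy
    have hpos : 0 < 1 - y + y ^ 2 / 2 := by nlinarith [sq_nonneg (y - 1)]
    rw [Real.exp_neg, inv_le_comm₀ (Real.exp_pos _) hpos]
    refine le_trans ?_ hq
    rw [inv_le_iff_one_le_mul₀ hpos]
    nlinarith [sq_nonneg (y ^ 2)]
  linarith

/-- One step decrease of the potential of exponential weights. -/
lemma log_sum_exp_step_le {η : ℝ} (hη : 0 < η) (x : Fin n → ℝ) (i : Fin n) {l : ℝ}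
    (hl : 0 ≤ l) :
    Real.log (∑ j, Real.exp (-(η * step η x i l j))) / η ≤
      Real.log (∑ j, Real.exp (-(η * x j))) / η - l + η / 2 * (l ^ 2 / gibbs η x i) := by
  set p := gibbs η x i with hp
  have hp0 : 0 < p := gibbs_pos η x i
  set Z := ∑ j, Real.exp (-(η * x j)) with hZ
  have hZ0 : 0 < Z := sum_exp_pos η x
  set y := η * l / p with hy
  have hy0 : 0 ≤ y := by positivity
  -- Only the weight of arm `i`, a fraction `p` of the total `Z`, is multiplied by e^(-y).
  have hsum : ∑ j, Real.exp (-(η * step η x i l j)) = Z * (1 - p * (1 - Real.exp (-y))) := by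
    have h1 : ∀ j, Real.exp (-(η * step η x i l j)) = Real.exp (-(η * x j)) -
        if j = i then Real.exp (-(η * x j)) * (1 - Real.exp (-y)) else 0 := by
      intro j
      by_cases hj : j = i
      · subst hj
        simp only [step, if_true]
        rw [mul_sub, mul_one, sub_sub_cancel, ← Real.exp_add]
        congr 1
        rw [hy]; ring
      · simp [step, hj]
    have h2 : Real.exp (-(η * x i)) = Z * p := by
      rw [hp, gibbs, ← hZ]; field_simp
    simp only [h1, Finset.sum_sub_distrib, Finset.sum_ite_eq', Finset.mem_univ, if_true]
    rw [← hZ, h2]; ring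
  have hlog : Real.log (∑ j, Real.exp (-(η * step η x i l j))) ≤
      Real.log Z - p * (1 - Real.exp (-y)) := by
    have hpos : 0 < 1 - p * (1 - Real.exp (-y)) := by
      have : 0 < Z * (1 - p * (1 - Real.exp (-y))) := hsum ▸ sum_exp_pos η _
      exact pos_of_mul_pos_right this hZ0.le
    rw [hsum, Real.log_mul hZ0.ne' hpos.ne']
    have := Real.log_le_sub_one_of_pos hpos
    linarith
  have h3 : p * (y - y ^ 2 / 2) ≤ p * (1 - Real.exp (-y)) :=
    mul_le_mul_of_nonneg_left (sub_sq_div_two_le_one_sub_exp_neg hy0) hp0.le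
  have h4 : p * (y - y ^ 2 / 2) = η * l - η * (η / 2 * (l ^ 2 / p)) := by
    rw [hy]; field_simp
  rw [div_le_iff₀ hη, add_mul, sub_mul, div_mul_cancel₀ _ hη.ne']
  linarith

lemma measurable_sum_loss_arm (η : ℝ) (N : ℕ) (ℓ : ℕ → Fin n → ℝ) (x : Fin n → ℝ) :
    Measurable fun u : ℕ → ℝ => ∑ t ∈ Finset.range N, ℓ t (arm η ℓ x u t) := by
  have h : ∀ t, Measurable fun u : ℕ → ℝ => arm η ℓ x u t :=
    measurable_arm (ℓ := fun _ => ℓ) (u := fun u => u) (fun _ _ => measurable_const)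
      measurable_pi_apply
  exact Finset.measurable_sum _ fun t _ => (measurable_of_finite (ℓ t)).comp (h t)

lemma integrable_sum_loss_arm (η : ℝ) (N : ℕ) {ℓ : ℕ → Fin n → ℝ} {B : ℕ → ℝ}
    (h0 : ∀ t i, 0 ≤ ℓ t i) (hB : ∀ t i, ℓ t i ≤ B t) (x : Fin n → ℝ) (ν : Measure (ℕ → ℝ))
    [IsProbabilityMeasure ν] :
    Integrable (fun u : ℕ → ℝ => ∑ t ∈ Finset.range N, ℓ t (arm η ℓ x u t)) ν := by
  refine Integrable.of_bound (measurable_sum_loss_arm η N ℓ x).aestronglyMeasurable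
    (∑ t ∈ Finset.range N, B t) (ae_of_all _ fun u => ?_)
  rw [Real.norm_of_nonneg (Finset.sum_nonneg fun _ _ => h0 _ _)]
  exact Finset.sum_le_sum fun _ _ => hB _ _

/-- The expected loss of EXP3 after conditioning on the first arm. -/
lemma integral_loss_succ (η : ℝ) (N : ℕ) {ℓ : ℕ → Fin n → ℝ} {B : ℕ → ℝ}
    (h0 : ∀ t i, 0 ≤ ℓ t i) (hB : ∀ t i, ℓ t i ≤ B t) (x : Fin n → ℝ) :
    ∫ u, ∑ t ∈ Finset.range (N + 1), ℓ t (arm η ℓ x u t) ∂(seedLaw (N + 1)) =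
      ∑ i, gibbs η x i * (ℓ 0 i + ∫ u, ∑ t ∈ Finset.range N,
        ℓ (t + 1) (arm η (fun s => ℓ (s + 1)) (step η x i (ℓ 0 i)) u t) ∂(seedLaw N)) := by
  have hI := integrable_sum_loss_arm η (N + 1) h0 hB x (seedLaw (N + 1))
  have hI' := fun y => integrable_sum_loss_arm η N (ℓ := fun s => ℓ (s + 1))
    (fun t i => h0 (t + 1) i) (fun t i => hB (t + 1) i) y (seedLaw N)
  rw [seedLaw] at hI ⊢
  rw [integral_map measurable_seedCons.aemeasurable hI.aestronglyMeasurable,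
    integral_prod (fun p : ℝ × (ℕ → ℝ) => ∑ t ∈ Finset.range (N + 1),
      ℓ t (arm η ℓ x (seedCons p.1 p.2) t)) (hI.comp_measurable measurable_seedCons),
    ← integral_sample (fun i => (gibbs_pos η x i).le) (sum_gibbs η x)]
  refine integral_congr_ae (ae_of_all _ fun a => ?_)
  simp only [Finset.sum_range_succ', arm_seedCons_succ, arm_seedCons_zero]
  rw [integral_add (hI' _) (integrable_const _)]
  simp only [integral_const, probReal_univ, smul_eq_mul, one_mul]
  rw [add_comm]

/-- The regret bound of EXP3, for the losses of an oblivious adversary. -/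
theorem integral_loss_le {η : ℝ} (hη : 0 < η) (i₀ : Fin n) (N : ℕ) (ℓ : ℕ → Fin n → ℝ)
    (B : ℕ → ℝ) (h0 : ∀ t i, 0 ≤ ℓ t i) (hB : ∀ t i, ℓ t i ≤ B t) (x : Fin n → ℝ) :
    ∫ u, ∑ t ∈ Finset.range N, ℓ t (arm η ℓ x u t) ∂(seedLaw N) ≤
      Real.log (∑ j, Real.exp (-(η * x j))) / η + x i₀ + ∑ t ∈ Finset.range N, ℓ t i₀ +
        η / 2 * n * ∑ t ∈ Finset.range N, B t ^ 2 := by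
  induction N generalizing ℓ B x with
  | zero =>
    -- The final potential dominates the single term of the comparator.
    have h : -(η * x i₀) ≤ Real.log (∑ j, Real.exp (-(η * x j))) := by
      rw [Real.le_log_iff_exp_le (sum_exp_pos η x)]
      exact Finset.single_le_sum (f := fun j => Real.exp (-(η * x j)))
        (fun _ _ => (Real.exp_pos _).le) (Finset.mem_univ i₀)
    have : -x i₀ ≤ Real.log (∑ j, Real.exp (-(η * x j))) / η := by
      rw [le_div_iff₀ hη]; linarith
    simp only [Finset.range_zero, Finset.sum_empty, integral_zero, mul_zero, add_zero]
    linarith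
  | succ N ih =>
    rw [integral_loss_succ η N h0 hB]
    set p := gibbs η x with hp
    set R := η / 2 * n * ∑ t ∈ Finset.range N, B (t + 1) ^ 2 with hR
    set Φ := Real.log (∑ j, Real.exp (-(η * x j))) / η with hΦ
    -- Weighting by `p i` cancels the importance weight 1 / `p i`. The second-order term then costs
    -- η/2 · B₀² per arm, whence the factor `n` after summation, and the estimated loss of `i₀`
    -- becomes its true loss.
    have hstep : ∀ i, p i * (ℓ 0 i + ∫ u, ∑ t ∈ Finset.range N,
          ℓ (t + 1) (arm η (fun s => ℓ (s + 1)) (step η x i (ℓ 0 i)) u t) ∂(seedLaw N)) ≤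
        p i * (Φ + x i₀ + ∑ t ∈ Finset.range N, ℓ (t + 1) i₀ + R) +
          η / 2 * B 0 ^ 2 + (if i₀ = i then ℓ 0 i else 0) := by
      intro i
      have hpi : 0 < p i := gibbs_pos η x i
      have h1 := ih (fun s => ℓ (s + 1)) (fun s => B (s + 1)) (fun _ _ => h0 _ _)
        (fun _ _ => hB _ _) (step η x i (ℓ 0 i))
      have h2 := log_sum_exp_step_le hη x i (h0 0 i)
      have h3 : p i * (η / 2 * (ℓ 0 i ^ 2 / p i)) ≤ η / 2 * B 0 ^ 2 := by
        have e : p i * (η / 2 * (ℓ 0 i ^ 2 / p i)) = η / 2 * ℓ 0 i ^ 2 := by field_simp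
        rw [e]
        have := pow_le_pow_left₀ (h0 0 i) (hB 0 i) 2
        have := half_pos hη
        gcongr
      have h4 : p i * step η x i (ℓ 0 i) i₀ = p i * x i₀ + if i₀ = i then ℓ 0 i else 0 := by
        simp only [step]
        split_ifs with h
        · rw [← hp]; field_simp
        · simp
      have h5 : ℓ 0 i + ∫ u, ∑ t ∈ Finset.range N,
          ℓ (t + 1) (arm η (fun s => ℓ (s + 1)) (step η x i (ℓ 0 i)) u t) ∂(seedLaw N) ≤
          Φ + η / 2 * (ℓ 0 i ^ 2 / p i) + step η x i (ℓ 0 i) i₀ +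
            ∑ t ∈ Finset.range N, ℓ (t + 1) i₀ + R := by linarith
      refine (mul_le_mul_of_nonneg_left h5 hpi.le).trans ?_
      simp only [mul_add, h4]
      linarith
    refine (Finset.sum_le_sum fun i _ => hstep i).trans (le_of_eq ?_)
    rw [Finset.sum_add_distrib, Finset.sum_add_distrib, ← Finset.sum_mul, hp, sum_gibbs]
    simp only [Finset.sum_ite_eq, Finset.mem_univ, if_true, Finset.sum_const, Finset.card_univ,
      Fintype.card_fin, nsmul_eq_mul]
    rw [Finset.sum_range_succ' (fun t => ℓ t i₀), Finset.sum_range_succ' (fun t => B t ^ 2), hR]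
    ring

end Bandit

end

noncomputable section

namespace Scheduling

/-! ### Shifted arrivals -/

lemma le_shiftedArrival (S : Finset ℕ) (L a t : ℕ) : a ≤ shiftedArrival S L a t := by
  induction t with
  | zero => exact le_rfl
  | succ t ih => rw [shiftedArrival]; split_ifs <;> omega

/-- A moved arrival lands just after the cleared window, hence never overtakes an arrival beyond it.
This keeps the arrival order of blocks valid. -/
lemma shiftedArrival_mono (S : Finset ℕ) (L t : ℕ) {a b : ℕ} (h : a ≤ b) :
    shiftedArrival S L a t ≤ shiftedArrival S L b t := by
  induction t with
  | zero => exact h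
  | succ t ih =>
    simp only [shiftedArrival]
    by_cases hS : t + 1 ∈ S
    · simp only [hS, true_and]; split_ifs <;> omega
    · simpa [hS] using ih

/-- After a restart at time `r`, no job arrives in `[r, r + L]`. -/
lemma shiftedArrival_gap {S : Finset ℕ} {L a t r : ℕ} (hr : r ∈ S) (h1 : 1 ≤ r) (hrt : r ≤ t) :
    shiftedArrival S L a t < r ∨ r + L < shiftedArrival S L a t := by
  induction t with
  | zero => omega
  | succ t ih =>
    rw [shiftedArrival]
    rcases Nat.lt_or_ge t r with h | h
    · have : r = t + 1 := by omega
      subst this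
      simp only [hr, true_and]
      split_ifs <;> omega
    · have := ih h
      split_ifs <;> omega

lemma lastRestart_le (S : Finset ℕ) (a : ℕ) : lastRestart S a ≤ a := by
  refine Finset.sup_le fun q hq => ?_
  exact (Finset.mem_filter.1 hq).2

lemma le_lastRestart {S : Finset ℕ} {q a : ℕ} (hq : q ∈ S) (h : q ≤ a) : q ≤ lastRestart S a :=
  Finset.le_sup (f := id) (Finset.mem_filter.2 ⟨hq, h⟩)

lemma lastRestart_mem {S : Finset ℕ} {a : ℕ} (h : lastRestart S a ≠ 0) : lastRestart S a ∈ S := by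
  have hne : (S.filter (· ≤ a)).Nonempty := by
    rw [Finset.nonempty_iff_ne_empty]
    intro h'
    exact h (by simp [lastRestart, h'])
  obtain ⟨q, hq, e⟩ := Finset.exists_mem_eq_sup _ hne id
  rw [lastRestart, e]
  exact (Finset.mem_filter.1 hq).1

/-! ### Blocks -/

variable {P : Params} {S : Finset ℕ} {J : Instance} {r k s t : ℕ}

lemma le_newArrival (P : Params) (S : Finset ℕ) (J : Instance) (k : ℕ) :
    (J.job k).arrival ≤ newArrival P S J k := le_shiftedArrival _ _ _ _

lemma mem_block : k ∈ (block P S J r).ids ↔ k ∈ J.ids ∧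
    newArrival P S J k ≤ (J.job k).deadline ∧ lastRestart S (newArrival P S J k) = r := by
  simp [block]

/-- Delaying an arrival under a fixed latest start only shrinks the waiting window, and jobs whose
window became empty have been dropped; so candidates may be run on blocks. -/
lemma block_valid (S : Finset ℕ) (hJ : J.Valid P) (r : ℕ) : (block P S J r).Valid P where
  arrival_mem k hk := by
    obtain ⟨hk, h, -⟩ := mem_block.1 hk
    exact ⟨(hJ.arrival_mem k hk).1.trans (le_newArrival P S J k), h.trans (hJ.deadline_le k hk)⟩
  deadline_mem k hk := by
    obtain ⟨hk, h, -⟩ := mem_block.1 hk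
    exact ⟨h, (hJ.deadline_mem k hk).2.trans (Nat.add_le_add_right (le_newArrival P S J k) _)⟩
  deadline_le k hk := hJ.deadline_le k (mem_block.1 hk).1
  length_le k hk := hJ.length_le k (mem_block.1 hk).1
  value_mem k hk := hJ.value_mem k (mem_block.1 hk).1
  arrival_mono k hk k' hk' h := shiftedArrival_mono _ _ _
    (hJ.arrival_mono k (mem_block.1 hk).1 k' (mem_block.1 hk').1 h)

/-- The first job handled after a restart at `r` arrives later than `r + lmax + dmax`. -/
lemma lastRestart_add_lt_newArrival (hS : S ⊆ Finset.Icc 1 P.T)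
    (hr : lastRestart S (newArrival P S J k) = r) (h0 : r ≠ 0) :
    r + (P.lmax + P.dmax) < newArrival P S J k := by
  have hmem : r ∈ S := hr ▸ lastRestart_mem (hr.symm ▸ h0)
  have h := Finset.mem_Icc.1 (hS hmem)
  rcases shiftedArrival_gap (L := P.lmax + P.dmax) (a := (J.job k).arrival) hmem h.1 h.2
    with h' | h'
  · have : r ≤ newArrival P S J k := hr ▸ lastRestart_le _ _
    exact absurd h' (not_lt.2 this)
  · exact h'

lemma start_block (A : Mechanism P) (hJ : J.Valid P)
    (h : A.start (block P S J r) k = some s) :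
    k ∈ J.ids ∧ lastRestart S (newArrival P S J k) = r ∧ newArrival P S J k ≤ s ∧
      s ≤ (J.job k).deadline ∧ s + (J.job k).length ≤ newArrival P S J k + (P.lmax + P.dmax) := by
  obtain ⟨hk, h1, h2⟩ := A.start_mem _ (block_valid S hJ r) k s h
  obtain ⟨hk', h3, h4⟩ := mem_block.1 hk
  have h5 := ((block_valid S hJ r).deadline_mem k hk).2
  have h6 := hJ.length_le k hk'
  refine ⟨hk', h4, h1, h2, ?_⟩
  have e : ((block P S J r).job k).arrival = newArrival P S J k := rfl
  rw [e] at h5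
  omega

lemma mem_running {σ : Schedule} : k ∈ running σ J t ↔
    k ∈ J.ids ∧ ∃ s, σ k = some s ∧ s ≤ t ∧ t < s + (J.job k).length := by
  simp [running]

/-- The time units in which the jobs of different blocks are processed do not overlap. -/
lemma lastRestart_of_mem_running_block (A : Mechanism P) (hJ : J.Valid P)
    (hS : S ⊆ Finset.Icc 1 P.T)
    (h : k ∈ running (A.start (block P S J r)) (block P S J r) t) :
    lastRestart S (t - (P.lmax + P.dmax)) = r := by
  obtain ⟨hk, s, hs, hst, hts⟩ := mem_running.1 h
  obtain ⟨-, hr, h1, -, h2⟩ := start_block A hJ hs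
  have hts : t < s + (J.job k).length := hts
  have hlt : ∀ q ∈ S, newArrival P S J k < q → t - (P.lmax + P.dmax) < q := by omega
  -- With L = lmax + dmax, the job ends by its new arrival + L, so t - L does not pass the new
  -- arrival, whose last restart is `r`. Conversely, for r ≠ 0, r + L < new arrival ≤ t puts `r` at
  -- or before t - L.
  have hle : lastRestart S (t - (P.lmax + P.dmax)) ≤ r := by
    by_cases h0 : lastRestart S (t - (P.lmax + P.dmax)) = 0
    · omega
    · have hm := lastRestart_mem h0
      by_contra hcon
      have h3 : newArrival P S J k < lastRestart S (t - (P.lmax + P.dmax)) := by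
        by_contra h4
        have := le_lastRestart hm (not_lt.1 h4)
        omega
      have := hlt _ hm h3
      have := lastRestart_le S (t - (P.lmax + P.dmax))
      omega
  refine le_antisymm hle ?_
  by_cases h0 : r = 0
  · omega
  · have := lastRestart_add_lt_newArrival hS hr h0
    exact le_lastRestart (hr ▸ lastRestart_mem (hr.symm ▸ h0)) (by omega)

/-! ### Running a different mechanism on each block -/

/-- The schedule obtained by running the mechanism `A (c r)` on the block that starts with the
restart `r`. -/
def composite {n : ℕ} (A : Fin n → Mechanism P) (S : Finset ℕ) (c : ℕ → Fin n) (J : Instance) :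
    Schedule :=
  fun k => (A (c (lastRestart S (newArrival P S J k)))).start
    (block P S J (lastRestart S (newArrival P S J k))) k

/-- The welfare that the mechanism `A` generates on the block that starts with the restart `r`. -/
def blockWelfare (A : Mechanism P) (S : Finset ℕ) (J : Instance) (r : ℕ) : ℝ :=
  welfare P (A.start (block P S J r)) (block P S J r)

variable (P) in
/-- The number of time units in which jobs of the block `r` may be processed. -/
def blockLength (S : Finset ℕ) (r : ℕ) : ℕ :=
  ((Finset.Icc 1 P.T).filter fun t => lastRestart S (t - (P.lmax + P.dmax)) = r).card

lemma welfareAt_nonneg (σ : Schedule) (hJ : J.Valid P) (t : ℕ) : 0 ≤ welfareAt σ J t :=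
  Finset.sum_nonneg fun k hk => (hJ.value_mem k (mem_running.1 hk).1).1

lemma welfare_nonneg (σ : Schedule) (hJ : J.Valid P) : 0 ≤ welfare P σ J :=
  Finset.sum_nonneg fun t _ => welfareAt_nonneg σ hJ t

lemma welfareAt_le (A : Mechanism P) (hJ : J.Valid P) (t : ℕ) :
    welfareAt (A.start J) J t ≤ P.m * P.vmax := by
  refine (Finset.sum_le_card_nsmul _ _ P.vmax fun k hk =>
    (hJ.value_mem k (mem_running.1 hk).1).2).trans ?_
  rw [nsmul_eq_mul]
  exact mul_le_mul_of_nonneg_right (Nat.cast_le.2 (A.feasible J hJ t)) P.vmax_nonneg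

lemma welfare_le (A : Mechanism P) (hJ : J.Valid P) :
    welfare P (A.start J) J ≤ P.m * P.vmax * P.T := by
  refine (Finset.sum_le_card_nsmul _ _ _ fun t _ => welfareAt_le A hJ t).trans (le_of_eq ?_)
  simp [mul_comm]

lemma blockWelfare_nonneg (A : Mechanism P) (S : Finset ℕ) (hJ : J.Valid P) (r : ℕ) :
    0 ≤ blockWelfare A S J r := welfare_nonneg _ (block_valid S hJ r)

lemma blockWelfare_le (A : Mechanism P) (hS : S ⊆ Finset.Icc 1 P.T) (hJ : J.Valid P) (r : ℕ) :
    blockWelfare A S J r ≤ P.m * P.vmax * blockLength P S r := by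
  have h : ∀ t ∈ Finset.Icc 1 P.T,
      welfareAt (A.start (block P S J r)) (block P S J r) t ≤
        if lastRestart S (t - (P.lmax + P.dmax)) = r then P.m * P.vmax else 0 := by
    intro t _
    split_ifs with ht
    · exact welfareAt_le A (block_valid S hJ r) t
    · rw [welfareAt, Finset.eq_empty_of_forall_notMem fun k hk =>
        ht (lastRestart_of_mem_running_block A hJ hS hk)]
      simp
  refine (Finset.sum_le_sum h).trans (le_of_eq ?_)
  rw [← Finset.sum_filter, Finset.sum_const, blockLength, nsmul_eq_mul, mul_comm]

section composite

variable {n : ℕ} {A : Fin n → Mechanism P} {c : ℕ → Fin n}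

lemma composite_eq_some (hJ : J.Valid P) : composite A S c J k = some s ↔
    ∃ r, (A (c r)).start (block P S J r) k = some s := by
  constructor
  · intro h; exact ⟨_, h⟩
  · rintro ⟨r, h⟩
    obtain ⟨-, rfl, -⟩ := start_block _ hJ h
    exact h

lemma running_block_eq (hJ : J.Valid P) (r t : ℕ) :
    running ((A (c r)).start (block P S J r)) (block P S J r) t =
      (running (composite A S c J) J t).filter
        fun k => lastRestart S (newArrival P S J k) = r := by
  ext k
  rw [Finset.mem_filter, mem_running, mem_running]
  constructor
  · rintro ⟨hk, s, hs, h⟩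
    obtain ⟨hk', h', -⟩ := start_block _ hJ hs
    exact ⟨⟨hk', s, (composite_eq_some hJ).2 ⟨r, hs⟩, h⟩, h'⟩
  · rintro ⟨⟨hk, s, hs, h⟩, rfl⟩
    exact ⟨((A _).start_mem _ (block_valid S hJ _) k s hs).1, s, hs, h⟩

/-- The composite schedule generates on each block the welfare of the mechanism in charge. -/
lemma welfare_composite (hJ : J.Valid P) :
    welfare P (composite A S c J) J =
      ∑ r ∈ Finset.range (P.T + 1), blockWelfare (A (c r)) S J r := by
  simp only [blockWelfare, welfare]
  rw [Finset.sum_comm]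
  refine Finset.sum_congr rfl fun t _ => ?_
  simp only [welfareAt, running_block_eq hJ]
  refine (Finset.sum_fiberwise_of_maps_to (fun k hk => ?_) _).symm
  -- A block label is at most the new arrival, hence at most the latest start, hence at most `T`;
  -- with the label 0 this makes `T + 1` rounds.
  obtain ⟨hk, s, hs, -⟩ := mem_running.1 hk
  obtain ⟨-, -, h1, h2, -⟩ := start_block _ hJ hs
  have h3 := hJ.deadline_le k hk
  have h4 := lastRestart_le S (newArrival P S J k)
  exact Finset.mem_range.2 (by omega)

lemma composite_start_mem (hJ : J.Valid P) (h : composite A S c J k = some s) :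
    k ∈ J.ids ∧ (J.job k).arrival ≤ s ∧ s ≤ (J.job k).deadline := by
  obtain ⟨hk, -, h1, h2, -⟩ := start_block _ hJ h
  exact ⟨hk, (le_newArrival P S J k).trans h1, h2⟩

/-- All jobs running at `t` belong to one block, so the machine bound of the candidate in charge of
it applies. -/
lemma composite_feasible (hS : S ⊆ Finset.Icc 1 P.T) (hJ : J.Valid P) (t : ℕ) :
    (running (composite A S c J) J t).card ≤ P.m := by
  refine le_trans (Finset.card_le_card ?_) ((A (c (lastRestart S (t - (P.lmax + P.dmax))))).feasible
    _ (block_valid S hJ (lastRestart S (t - (P.lmax + P.dmax)))) t)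
  intro k hk
  have h : k ∈ running ((A (c (lastRestart S (newArrival P S J k)))).start
      (block P S J (lastRestart S (newArrival P S J k))))
      (block P S J (lastRestart S (newArrival P S J k))) t := by
    rw [running_block_eq hJ]
    exact Finset.mem_filter.2 ⟨hk, rfl⟩
  rwa [lastRestart_of_mem_running_block _ hJ hS h]

end composite

/-! ### The expected square of the block lengths -/

/-- The probability of no restart in `F`: a factor 1 - γ for each point of `F`, times the total mass
of the subsets of `U \ F`, which is 1. -/
lemma sum_weight_disjoint (γ : ℝ) {U F : Finset ℕ} (hF : F ⊆ U) :
    ∑ S ∈ U.powerset, γ ^ S.card * (1 - γ) ^ (U.card - S.card) *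
      (if Disjoint S F then 1 else 0) = (1 - γ) ^ F.card := by
  have h1 : U.powerset.filter (fun S => Disjoint S F) = (U \ F).powerset := by
    ext S
    simp [Finset.subset_sdiff]
  simp only [mul_ite, mul_one, mul_zero]
  rw [← Finset.sum_filter, h1]
  have h2 : ∀ S ∈ (U \ F).powerset, γ ^ S.card * (1 - γ) ^ (U.card - S.card) =
      γ ^ S.card * (1 - γ) ^ ((U \ F).card - S.card) * (1 - γ) ^ F.card := by
    intro S hS
    have h3 := Finset.card_le_card (Finset.mem_powerset.1 hS)
    have h4 := Finset.card_sdiff_add_card_eq_card hF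
    rw [mul_assoc, ← pow_add]
    congr 2
    omega
  rw [Finset.sum_congr rfl h2, ← Finset.sum_mul, Finset.sum_pow_mul_eq_add_pow]
  simp

lemma sum_pow_le_of_injOn {q : ℝ} (h0 : 0 ≤ q) (h1 : q < 1) (F : Finset ℕ) {f : ℕ → ℕ}
    (hf : Set.InjOn f F) : ∑ t ∈ F, q ^ f t ≤ (1 - q)⁻¹ := by
  rw [← Finset.sum_image (f := fun j => q ^ j) hf, ← tsum_geometric_of_lt_one h0 h1]
  exact (summable_geometric_of_lt_one h0 h1).sum_le_tsum _ fun _ _ => pow_nonneg h0 _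

lemma sum_pow_dist_le {q : ℝ} (h0 : 0 ≤ q) (h1 : q < 1) (T L x : ℕ) :
    ∑ t ∈ Finset.Icc 1 T, q ^ ((t - L - x) + (x - (t - L))) ≤ L + 2 * (1 - q)⁻¹ := by
  -- The exponent is |(t - L) - x| written with truncated subtraction. The times up to `L` all
  -- collapse to t - L = 0 and are bounded by 1 each; on either side of L + x the exponents are
  -- distinct, giving one geometric series each.
  have hsub : Finset.Icc 1 T ⊆ Finset.Icc 1 L ∪
      (((Finset.Icc 1 T).filter fun t => L + x ≤ t) ∪
        ((Finset.Icc 1 T).filter fun t => L < t ∧ t < L + x)) := by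
    intro t ht
    simp only [Finset.mem_union, Finset.mem_filter, Finset.mem_Icc] at ht ⊢
    omega
  have hle : ∀ (F G : Finset ℕ) (f : ℕ → ℕ), ∑ t ∈ F ∪ G, q ^ f t ≤
      ∑ t ∈ F, q ^ f t + ∑ t ∈ G, q ^ f t := by
    intro F G f
    rw [← Finset.sum_union_inter]
    have : 0 ≤ ∑ t ∈ F ∩ G, q ^ f t := Finset.sum_nonneg fun _ _ => pow_nonneg h0 _
    linarith
  refine (Finset.sum_le_sum_of_subset_of_nonneg hsub fun _ _ _ => pow_nonneg h0 _).trans ?_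
  refine (hle _ _ _).trans (add_le_add ?_ ((hle _ _ _).trans ?_))
  · refine (Finset.sum_le_card_nsmul _ _ 1 fun _ _ => pow_le_one₀ h0 h1.le).trans ?_
    simp
  · rw [two_mul]
    refine add_le_add (sum_pow_le_of_injOn h0 h1 _ ?_) (sum_pow_le_of_injOn h0 h1 _ ?_)
    · intro a ha b hb hab
      simp only [Finset.coe_filter, Set.mem_ofPred_eq] at ha hb hab
      omega
    · intro a ha b hb hab
      simp only [Finset.coe_filter, Set.mem_ofPred_eq] at ha hb hab
      omega

/-- A squared length counts pairs of times in the block. Two times with the same last restart have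
no restart between them, since it would be a later last restart for the later time. -/
lemma sum_blockLength_sq_le (P : Params) (S : Finset ℕ) :
    ∑ r ∈ Finset.range (P.T + 1), (blockLength P S r : ℝ) ^ 2 ≤
      ∑ t ∈ Finset.Icc 1 P.T, ∑ t' ∈ Finset.Icc 1 P.T,
        if Disjoint S (Finset.Ioc (t - (P.lmax + P.dmax)) (t' - (P.lmax + P.dmax)) ∪
          Finset.Ioc (t' - (P.lmax + P.dmax)) (t - (P.lmax + P.dmax))) then 1 else 0 := by
  set L := P.lmax + P.dmax with hL
  have h1 : ∀ r, (blockLength P S r : ℝ) = ∑ t ∈ Finset.Icc 1 P.T,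
      if lastRestart S (t - L) = r then 1 else 0 := by
    intro r
    rw [blockLength, Finset.card_filter]
    push_cast
    rfl
  simp only [h1, sq, Finset.sum_mul_sum]
  rw [Finset.sum_comm]
  refine Finset.sum_le_sum fun t _ => ?_
  rw [Finset.sum_comm]
  refine Finset.sum_le_sum fun t' _ => ?_
  simp only [ite_mul, one_mul, zero_mul]
  rw [Finset.sum_ite_eq]
  split_ifs with h2 h3 h4 h5
  · exact le_rfl
  · exfalso
    apply h4
    rw [Finset.disjoint_left]
    intro q hq hq'
    simp only [Finset.mem_union, Finset.mem_Ioc] at hq'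
    have a1 := lastRestart_le S (t - L)
    have a2 := lastRestart_le S (t' - L)
    rcases hq' with hq' | hq'
    · have := le_lastRestart hq hq'.2
      omega
    · have := le_lastRestart hq hq'.2
      omega
  all_goals norm_num

/-- With restarts at rate `γ`, the expected sum of the squares of the block lengths is of the
order `T / γ`. -/
lemma expected_blockLength_sq_le (P : Params) {γ : ℝ} (h0 : 0 < γ) (h1 : γ ≤ 1)
    (hL : γ * ((P.lmax : ℝ) + P.dmax) ≤ 1) :
    ∑ S ∈ (Finset.Icc 1 P.T).powerset, γ ^ S.card * (1 - γ) ^ (P.T - S.card) *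
      ∑ r ∈ Finset.range (P.T + 1), (blockLength P S r : ℝ) ^ 2 ≤ 3 * P.T / γ := by
  set L := P.lmax + P.dmax with hLdef
  set F : ℕ → ℕ → Finset ℕ := fun t t' => Finset.Ioc (t - L) (t' - L) ∪ Finset.Ioc (t' - L) (t - L)
    with hF
  have hcard : ∀ t t', (F t t').card = (t' - L - (t - L)) + (t - L - (t' - L)) := by
    intro t t'
    rw [hF, Finset.card_union_of_disjoint, Nat.card_Ioc, Nat.card_Ioc]
    rw [Finset.disjoint_left]
    intro q hq hq'
    rw [Finset.mem_Ioc] at hq hq'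
    omega
  have hsub : ∀ t ∈ Finset.Icc 1 P.T, ∀ t' ∈ Finset.Icc 1 P.T, F t t' ⊆ Finset.Icc 1 P.T := by
    intro t ht t' ht' q hq
    simp only [hF, Finset.mem_union, Finset.mem_Ioc, Finset.mem_Icc] at *
    omega
  have hw : ∀ S : Finset ℕ, 0 ≤ γ ^ S.card * (1 - γ) ^ (P.T - S.card) := fun S =>
    mul_nonneg (pow_nonneg h0.le _) (pow_nonneg (by linarith) _)
  calc _ ≤ ∑ S ∈ (Finset.Icc 1 P.T).powerset, γ ^ S.card * (1 - γ) ^ (P.T - S.card) *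
        ∑ t ∈ Finset.Icc 1 P.T, ∑ t' ∈ Finset.Icc 1 P.T,
          (if Disjoint S (F t t') then 1 else 0) :=
        Finset.sum_le_sum fun S _ =>
          mul_le_mul_of_nonneg_left (sum_blockLength_sq_le P S) (hw S)
    _ = ∑ t ∈ Finset.Icc 1 P.T, ∑ t' ∈ Finset.Icc 1 P.T, (1 - γ) ^ (F t t').card := by
        simp only [Finset.mul_sum]
        rw [Finset.sum_comm]
        refine Finset.sum_congr rfl fun t ht => ?_
        rw [Finset.sum_comm]
        refine Finset.sum_congr rfl fun t' ht' => ?_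
        have := sum_weight_disjoint γ (hsub t ht t' ht')
        rwa [Nat.card_Icc, Nat.add_sub_cancel] at this
    _ ≤ ∑ t ∈ Finset.Icc 1 P.T, 3 / γ := by
        refine Finset.sum_le_sum fun t _ => ?_
        simp only [hcard]
        refine (sum_pow_dist_le (q := 1 - γ) (by linarith) (by linarith) P.T L (t - L)).trans ?_
        -- The constant 3 arises here: 1/γ absorbs the delay `L`, and the two geometric series give
        -- 2/γ.
        have hL' : (L : ℝ) ≤ γ⁻¹ := by
          rw [hLdef, ← one_div, le_div_iff₀ h0, mul_comm]
          push_cast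
          exact hL
        rw [sub_sub_cancel, div_eq_mul_inv]
        linarith
    _ = 3 * P.T / γ := by
        rw [Finset.sum_const, Nat.card_Icc, nsmul_eq_mul, Nat.add_sub_cancel]
        ring

end Scheduling

end

noncomputable section

namespace Scheduling

/-! ### Measurability of instances and schedules -/

section measurability

variable {α : Type*} [MeasurableSpace α]

lemma measurableSet_mem_ids (k : ℕ) : MeasurableSet {J : Instance | k ∈ J.ids} := by
  have h : MeasurableSpace.comap Instance.ids ⊤ ≤ (inferInstance : MeasurableSpace Instance) :=
    le_sup_left
  exact h _ ⟨{F | k ∈ F}, trivial, rfl⟩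

lemma measurable_job (k : ℕ) : Measurable fun J : Instance => J.job k := by
  have h : MeasurableSpace.comap Instance.job inferInstance ≤
    (inferInstance : MeasurableSpace Instance) := le_sup_right
  have h' : Measurable Instance.job := (comap_measurable Instance.job).mono h le_rfl
  exact (measurable_pi_apply k).comp h'

lemma measurable_job_tuple :
    Measurable fun j : Job => (j.arrival, j.deadline, j.length, j.value) :=
  comap_measurable _

lemma measurable_arrival (k : ℕ) : Measurable fun J : Instance => (J.job k).arrival :=
  (measurable_fst.comp measurable_job_tuple).comp (measurable_job k)

lemma measurable_deadline (k : ℕ) : Measurable fun J : Instance => (J.job k).deadline :=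
  (measurable_fst.comp (measurable_snd.comp measurable_job_tuple)).comp (measurable_job k)

lemma measurable_length (k : ℕ) : Measurable fun J : Instance => (J.job k).length :=
  (measurable_fst.comp (measurable_snd.comp (measurable_snd.comp measurable_job_tuple))).comp
    (measurable_job k)

lemma measurable_value (k : ℕ) : Measurable fun J : Instance => (J.job k).value :=
  (measurable_snd.comp (measurable_snd.comp (measurable_snd.comp measurable_job_tuple))).comp
    (measurable_job k)

lemma measurable_toInstance {f : α → Instance}
    (h1 : ∀ k, MeasurableSet {a | k ∈ (f a).ids})
    (h2 : ∀ k, Measurable fun a => ((f a).job k).arrival)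
    (h3 : ∀ k, Measurable fun a => ((f a).job k).deadline)
    (h4 : ∀ k, Measurable fun a => ((f a).job k).length)
    (h5 : ∀ k, Measurable fun a => ((f a).job k).value) : Measurable f := by
  have e1 : @Measurable _ _ _ (MeasurableSpace.comap Instance.ids ⊤) f := by
    refine @Measurable.of_comap_le _ _ _ (MeasurableSpace.comap Instance.ids ⊤) f ?_
    rw [MeasurableSpace.comap_comp]
    rintro _ ⟨s, -, rfl⟩
    -- There are only countably many finite sets of names, so even for the discrete σ-algebra
    -- membership of each name suffices.
    have : Instance.ids ∘ f ⁻¹' s = ⋃ F ∈ s, ⋂ k, {a | k ∈ (f a).ids ↔ k ∈ F} := by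
      ext a
      simp only [Set.mem_preimage, Function.comp, Set.mem_iUnion, Set.mem_iInter,
        Set.mem_ofPred_eq, exists_prop]
      constructor
      · intro h
        exact ⟨_, h, fun k => Iff.rfl⟩
      · rintro ⟨F, hF, h⟩
        rwa [Finset.ext h]
    rw [this]
    exact MeasurableSet.biUnion (Set.to_countable s) fun F _ => MeasurableSet.iInter fun k =>
      (h1 k).iff (MeasurableSet.const _)
  have e2 : Measurable fun a => (f a).job := by
    refine measurable_pi_lambda _ fun k => ?_
    refine Measurable.of_comap_le ?_
    rw [instMeasurableSpaceJob, MeasurableSpace.comap_comp]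
    exact ((h2 k).prodMk ((h3 k).prodMk ((h4 k).prodMk (h5 k)))).comap_le
  refine Measurable.of_comap_le ?_
  rw [instMeasurableSpaceInstance, MeasurableSpace.comap_sup]
  refine sup_le e1.comap_le ?_
  rw [MeasurableSpace.comap_comp]
  exact e2.comap_le

lemma measurable_welfare (P : Params) {σ : α → Schedule} {f : α → Instance}
    (hσ : ∀ k s, MeasurableSet {a | σ a k = some s}) (hf : Measurable f) :
    Measurable fun a => welfare P (σ a) (f a) := by
  refine Finset.measurable_sum _ fun t _ => ?_
  have hrun : ∀ k, MeasurableSet {a | k ∈ running (σ a) (f a) t} := by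
    intro k
    have : {a | k ∈ running (σ a) (f a) t} = {a | k ∈ (f a).ids} ∩
        ⋃ s, {a | σ a k = some s} ∩ ({_a | s ≤ t} ∩ {a | t < s + ((f a).job k).length}) := by
      ext a
      simp [mem_running]
    rw [this]
    exact (hf (measurableSet_mem_ids k)).inter (MeasurableSet.iUnion fun s =>
      (hσ k s).inter ((MeasurableSet.const _).inter
        (measurableSet_lt measurable_const (measurable_const.add ((measurable_length k).comp hf)))))
  classical
  -- The summation set varies with `a`, so the sum is written as a pointwise limit of sums over
  -- fixed ranges.
  refine measurable_of_tendsto_metrizable (f := fun N a => ∑ k ∈ Finset.range N,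
    if k ∈ running (σ a) (f a) t then ((f a).job k).value else 0) (fun N => ?_) ?_
  · exact Finset.measurable_sum _ fun k _ =>
      Measurable.ite (hrun k) ((measurable_value k).comp hf) measurable_const
  · rw [tendsto_pi_nhds]
    intro a
    have h := hasSum_sum_of_ne_finset_zero (L := SummationFilter.unconditional ℕ)
      (s := running (σ a) (f a) t)
      (f := fun k => if k ∈ running (σ a) (f a) t then ((f a).job k).value else 0)
      (fun k hk => if_neg hk)
    rw [Finset.sum_congr rfl fun k hk => if_pos hk] at h
    exact h.tendsto_sum_nat

lemma measurable_newArrival (P : Params) (S : Finset ℕ) (k : ℕ) :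
    Measurable fun J => newArrival P S J k :=
  (Measurable.of_discrete (f := fun a => shiftedArrival S (P.lmax + P.dmax) a P.T)).comp
    (measurable_arrival k)

lemma measurable_lastRestart_newArrival (P : Params) (S : Finset ℕ) (k : ℕ) :
    Measurable fun J => lastRestart S (newArrival P S J k) :=
  (Measurable.of_discrete (f := lastRestart S)).comp (measurable_newArrival P S k)

lemma measurable_block (P : Params) (S : Finset ℕ) (r : ℕ) :
    Measurable fun J => block P S J r := by
  refine measurable_toInstance (fun k => ?_) (measurable_newArrival P S) measurable_deadline
    measurable_length measurable_value
  simp only [mem_block]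
  exact (measurableSet_mem_ids k).inter ((measurableSet_le (measurable_newArrival P S k)
    (measurable_deadline k)).inter
      (measurable_lastRestart_newArrival P S k (measurableSet_singleton r)))

lemma measurable_blockWelfare {P : Params} (A : Mechanism P) (S : Finset ℕ) (r : ℕ) :
    Measurable fun J => blockWelfare A S J r :=
  measurable_welfare P (fun k s => measurable_block P S r (A.measurable_start k s))
    (measurable_block P S r)

lemma measurableSet_composite {P : Params} {n : ℕ} (A : Fin n → Mechanism P) (S : Finset ℕ)
    {c : α → ℕ → Fin n} {f : α → Instance} (hc : ∀ r, Measurable fun a => c a r)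
    (hf : Measurable f) (k s : ℕ) :
    MeasurableSet {a | composite A S (c a) (f a) k = some s} := by
  have : {a | composite A S (c a) (f a) k = some s} = ⋃ r, ⋃ i,
      {a | lastRestart S (newArrival P S (f a) k) = r} ∩ ((fun a => c a r) ⁻¹' {i} ∩
        {a | (A i).start (block P S (f a) r) k = some s}) := by
    ext a
    simp [composite]
  rw [this]
  exact MeasurableSet.iUnion fun r => MeasurableSet.iUnion fun i =>
    (((measurable_lastRestart_newArrival P S k).comp hf) (measurableSet_singleton r)).inter
      ((hc r (measurableSet_singleton i)).inter
        (((measurable_block P S r).comp hf) ((A i).measurable_start k s)))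

lemma RandomizedMechanism.measurable_expectedWelfare {P : Params} (M : RandomizedMechanism P) :
    Measurable fun J => M.expectedWelfare J := by
  let _ := M.mΩ
  have := M.isProb
  have h : Measurable fun p : M.Ω × Instance => welfare P ((M.mech p.1).start p.2) p.2 :=
    measurable_welfare P M.measurable_start measurable_snd
  exact (h.stronglyMeasurable.integral_prod_left (μ := M.μ)).measurable

end measurability

/-! ### Online information -/

lemma SameHistory.symm {start : Instance → Schedule} {t : ℕ} {J J' : Instance}
    (h : SameHistory start t J J') : SameHistory start t J' J where
  arrived k := (h.arrived k).symm
  reports k hk hkt := by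
    obtain ⟨hk', hkt'⟩ := (h.arrived k).2 ⟨hk, hkt⟩
    obtain ⟨h1, h2, h3⟩ := h.reports k hk' hkt'
    exact ⟨h1.symm, h2.symm, h3.symm⟩
  started k s hs := (h.started k s hs).symm
  completed k s hs hks hd := (h.completed k s hs ((h.started k s hs).2 hks) hd.symm).symm

section online

variable {P : Params} {n : ℕ} {A : Fin n → Mechanism P} {S : Finset ℕ}
  {c : Instance → ℕ → Fin n} {J J' : Instance} {t r k s : ℕ}

lemma SameHistory.newArrival_eq {start : Instance → Schedule} (h : SameHistory start t J J')
    (hk : k ∈ J.ids) (hkt : (J.job k).arrival ≤ t) :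
    newArrival P S J k = newArrival P S J' k := by
  rw [newArrival, newArrival, (h.reports k hk hkt).1]

/-- No agreement of `c J r` and `c J' r` is assumed: the common past of the composite schedules
already forces the same starts before `t`. -/
lemma SameHistory.start_block (h : SameHistory (fun J => composite A S (c J) J) t J J')
    (hJ : J.Valid P) (hs : s < t)
    (hk : (A (c J r)).start (block P S J r) k = some s) :
    (A (c J' r)).start (block P S J' r) k = some s := by
  obtain ⟨hkJ, hr, h1, -, -⟩ := Scheduling.start_block _ hJ hk
  have h2 : composite A S (c J') J' k = some s :=
    (h.started k s hs).1 ((composite_eq_some hJ).2 ⟨r, hk⟩)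
  have h3 := h.newArrival_eq (P := P) (S := S) hkJ
    ((le_newArrival P S J k).trans (h1.trans hs.le))
  rwa [composite, ← h3, hr] at h2

/-- `hdone` says that block `r` is over by `t`, the processing delay included. Thus every started
job in it is completed and its length is part of the history. -/
lemma SameHistory.mem_running_block (h : SameHistory (fun J => composite A S (c J) J) t J J')
    (hJ : J.Valid P)
    (hdone : ∀ a, lastRestart S a = r → a + (P.lmax + P.dmax) ≤ t) {τ : ℕ}
    (hk : k ∈ running ((A (c J r)).start (block P S J r)) (block P S J r) τ) :
    k ∈ running ((A (c J' r)).start (block P S J' r)) (block P S J' r) τ ∧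
      (J.job k).value = (J'.job k).value := by
  obtain ⟨hkb, s, hs, h1, h2⟩ := mem_running.1 hk
  have h2 : τ < s + (J.job k).length := h2
  obtain ⟨hkJ, hr, h3, h4, h5⟩ := Scheduling.start_block _ hJ hs
  have h6 := hdone _ hr
  have hst : s < t := by omega
  have hat : (J.job k).arrival ≤ t := (le_newArrival P S J k).trans (h3.trans hst.le)
  have hlen : (J.job k).length = (J'.job k).length :=
    h.completed k s hst ((composite_eq_some hJ).2 ⟨r, hs⟩) (Or.inl (by omega))
  obtain ⟨-, h7, h8⟩ := h.reports k hkJ hat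
  refine ⟨mem_running.2 ⟨mem_block.2 ⟨((h.arrived k).1 ⟨hkJ, hat⟩).1, ?_, ?_⟩, s,
    h.start_block hJ hst hs, h1, ?_⟩, h8⟩
  · rw [← h.newArrival_eq hkJ hat, ← h7]
    exact h3.trans h4
  · rw [← h.newArrival_eq hkJ hat, hr]
  · rw [hlen] at h2
    exact h2

/-- The welfare of a block that is over is known. -/
lemma SameHistory.blockWelfare_eq (h : SameHistory (fun J => composite A S (c J) J) t J J')
    (hJ : J.Valid P) (hJ' : J'.Valid P)
    (hdone : ∀ a, lastRestart S a = r → a + (P.lmax + P.dmax) ≤ t) :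
    blockWelfare (A (c J r)) S J r = blockWelfare (A (c J' r)) S J' r := by
  rw [blockWelfare, blockWelfare, welfare, welfare]
  refine Finset.sum_congr rfl fun τ _ => ?_
  have e : running ((A (c J r)).start (block P S J r)) (block P S J r) τ =
      running ((A (c J' r)).start (block P S J' r)) (block P S J' r) τ := by
    ext k
    exact ⟨fun hk => (h.mem_running_block hJ hdone hk).1,
      fun hk => (h.symm.mem_running_block hJ' hdone hk).1⟩
  rw [welfareAt, welfareAt, ← e]
  exact Finset.sum_congr rfl fun k hk => (h.mem_running_block hJ hdone hk).2

lemma SameHistory.mem_block_of_mem_block {start : Instance → Schedule}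
    (h : SameHistory start t J J') (hk : k ∈ (block P S J r).ids)
    (hkt : ((block P S J r).job k).arrival ≤ t) :
    k ∈ (block P S J' r).ids ∧ ((block P S J' r).job k).arrival ≤ t := by
  obtain ⟨hkJ, h1, h2⟩ := mem_block.1 hk
  have hat : (J.job k).arrival ≤ t := (le_newArrival P S J k).trans hkt
  have e := h.newArrival_eq (P := P) (S := S) hkJ hat
  refine ⟨mem_block.2 ⟨((h.arrived k).1 ⟨hkJ, hat⟩).1, ?_, ?_⟩, ?_⟩
  · rw [← e, ← (h.reports k hkJ hat).2.1]
    exact h1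
  · rw [← e, h2]
  · change newArrival P S J' k ≤ t
    rw [← e]
    exact hkt

/-- If the same mechanism is in charge of a block, then it has seen the same of it. -/
lemma SameHistory.block (h : SameHistory (fun J => composite A S (c J) J) t J J')
    (hJ : J.Valid P) (hJ' : J'.Valid P) (hc : c J r = c J' r) :
    SameHistory (A (c J r)).start t (block P S J r) (block P S J' r) where
  arrived k := ⟨fun hk => h.mem_block_of_mem_block hk.1 hk.2,
    fun hk => h.symm.mem_block_of_mem_block hk.1 hk.2⟩
  reports k hk hkt := by
    have hkJ := (mem_block.1 hk).1
    have hat : (J.job k).arrival ≤ t := (le_newArrival P S J k).trans hkt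
    exact ⟨h.newArrival_eq hkJ hat, (h.reports k hkJ hat).2⟩
  started k s hs := by
    constructor
    · intro hk
      have := h.start_block hJ hs hk
      rwa [← hc] at this
    · intro hk
      rw [hc] at hk
      exact h.symm.start_block hJ' hs hk
  completed k s hs hk hd :=
    h.completed k s hs ((composite_eq_some hJ).2 ⟨r, hk⟩) hd

end online

/-! ### The bandit over the blocks -/

variable {P : Params} {n : ℕ}

/-- The loss of the mechanism `A i` on the block `r`: its welfare, subtracted from the largest
possible one. -/
def blockLoss (A : Fin n → Mechanism P) (S : Finset ℕ) (J : Instance) (r : ℕ) (i : Fin n) : ℝ :=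
  P.m * P.vmax * blockLength P S r - blockWelfare (A i) S J r

variable [NeZero n]

/-- The index of the mechanism that EXP3 chooses for the block `r`. -/
def blockArm (η : ℝ) (A : Fin n → Mechanism P) (S : Finset ℕ) (u : ℕ → ℝ) (J : Instance) (r : ℕ) :
    Fin n :=
  Bandit.arm η (blockLoss A S J) 0 u r

lemma measurable_blockArm (η : ℝ) (A : Fin n → Mechanism P) (S : Finset ℕ) (r : ℕ) :
    Measurable fun p : (ℕ → ℝ) × Instance => blockArm η A S p.1 p.2 r := by
  refine Bandit.measurable_arm (ℓ := fun p : (ℕ → ℝ) × Instance => blockLoss A S p.2)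
    (u := fun p => p.1) (fun t i => ?_) (fun t => (measurable_pi_apply t).comp measurable_fst) r
  exact measurable_const.sub ((measurable_blockWelfare (A i) S t).comp measurable_snd)

/-- The choice for a block uses only what is known when its first job is handled. -/
lemma SameHistory.blockArm_eq {η : ℝ} {A : Fin n → Mechanism P} {S : Finset ℕ} {u : ℕ → ℝ}
    {J J' : Instance} {t k : ℕ} (hS : S ⊆ Finset.Icc 1 P.T)
    (h : SameHistory (fun J => composite A S (blockArm η A S u J) J) t J J')
    (hJ : J.Valid P) (hJ' : J'.Valid P) (hk : newArrival P S J k ≤ t) :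
    blockArm η A S u J (lastRestart S (newArrival P S J k)) =
      blockArm η A S u J' (lastRestart S (newArrival P S J k)) := by
  refine Bandit.arm_eq_of_forall_lt fun q hq e => ?_
  set r := lastRestart S (newArrival P S J k) with hr
  -- An earlier round `q < r` exists, so `r` is a genuine restart. Its window of length lmax + dmax
  -- precedes the first job of the block, and every block before `r` is over by `t`.
  have h0 : r ≠ 0 := by omega
  have h1 := lastRestart_add_lt_newArrival hS hr.symm h0
  have h2 := h.blockWelfare_eq (r := q) hJ hJ' fun a ha => by
    have : a < r := by
      by_contra hcon
      have := le_lastRestart (hr ▸ lastRestart_mem (hr ▸ h0)) (not_lt.1 hcon)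
      omega
    omega
  -- `h2` compares the welfares of the candidates chosen in `J` and in `J'`; by `e` they are the
  -- same candidate, which is the bandit feedback required.
  rw [show blockArm η A S u J' q = blockArm η A S u J q from e.symm] at h2
  exact congrArg (fun w => P.m * P.vmax * blockLength P S q - w) h2

/-- The mechanism that is restarted at the times in `S`, where EXP3 with the seeds `u` chooses the
candidate that is in charge from each restart on. -/
def banditMechanism (η : ℝ) (A : Fin n → Mechanism P) (S : Finset ℕ) (hS : S ⊆ Finset.Icc 1 P.T)
    (u : ℕ → ℝ) : Mechanism P where
  start J := composite A S (blockArm η A S u J) J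
  price J k := (A (blockArm η A S u J (lastRestart S (newArrival P S J k)))).price
    (block P S J (lastRestart S (newArrival P S J k))) k
  start_mem J hJ k s h := composite_start_mem hJ h
  feasible J hJ t := composite_feasible hS hJ t
  online := by
    have key : ∀ J J' : Instance, J.Valid P → J'.Valid P → ∀ t,
        SameHistory (fun J => composite A S (blockArm η A S u J) J) t J J' → ∀ k,
        composite A S (blockArm η A S u J) J k = some t →
        composite A S (blockArm η A S u J') J' k = some t := by
      intro J J' hJ hJ' t h k hk
      have h1 := (start_block _ hJ hk).2.2.1
      have h2 := h.blockArm_eq hS hJ hJ' h1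
      refine (composite_eq_some hJ').2 ⟨lastRestart S (newArrival P S J k), ?_⟩
      rw [← h2]
      exact ((A _).online _ _ (block_valid S hJ _) (block_valid S hJ' _) t (h.block hJ hJ' h2)
        k).1 hk
    exact fun J J' hJ hJ' t h k => ⟨key J J' hJ hJ' t h k, key J' J hJ' hJ t h.symm k⟩
  price_unscheduled J hJ k h := (A _).price_unscheduled _ (block_valid S hJ _) k h
  price_online J J' hJ hJ' t h k s hk hst hd := by
    obtain ⟨hkJ, -, h1, -⟩ := start_block _ hJ hk
    have h2 := h.blockArm_eq hS hJ hJ' (h1.trans hst.le)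
    have h3 := h.newArrival_eq (P := P) (S := S) hkJ
      ((le_newArrival P S J k).trans (h1.trans hst.le))
    rw [← h3, ← h2]
    exact (A _).price_online _ _ (block_valid S hJ _) (block_valid S hJ' _) t
      (h.block hJ hJ' h2) k s hk hst hd
  measurable_start k s := measurableSet_composite A S
    (fun r => (measurable_blockArm η A S r).comp (measurable_const.prodMk measurable_id))
    measurable_id k s

end Scheduling

end

noncomputable section

namespace Scheduling

variable {P : Params} {n : ℕ}

/-! ### The randomized mechanism -/

/-- The probability that the restarts take place exactly at the times in `S`. -/
def restartWeight (P : Params) (γ : ℝ) (S : Finset ℕ) : ℝ :=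
  γ ^ S.card * (1 - γ) ^ (P.T - S.card)

lemma restartWeight_nonneg {γ : ℝ} (h0 : 0 ≤ γ) (h1 : γ ≤ 1) (S : Finset ℕ) :
    0 ≤ restartWeight P γ S :=
  mul_nonneg (pow_nonneg h0 _) (pow_nonneg (by linarith) _)

lemma sum_restartWeight (P : Params) (γ : ℝ) :
    ∑ S ∈ (Finset.Icc 1 P.T).powerset, restartWeight P γ S = 1 := by
  have := Finset.sum_pow_mul_eq_add_pow γ (1 - γ) (Finset.Icc 1 P.T)
  simpa [restartWeight] using this

/-- The law of the restarts and, independently, the seeds of the bandit. -/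
def coinLaw (P : Params) (γ : ℝ) : Measure (Finset ℕ × (ℕ → ℝ)) :=
  ∑ S ∈ (Finset.Icc 1 P.T).powerset,
    ENNReal.ofReal (restartWeight P γ S) • (Bandit.seedLaw (P.T + 1)).map (Prod.mk S)

lemma isProbabilityMeasure_coinLaw {γ : ℝ} (h0 : 0 ≤ γ) (h1 : γ ≤ 1) :
    IsProbabilityMeasure (coinLaw P γ) := by
  constructor
  have h : ∀ S : Finset ℕ, ((Bandit.seedLaw (P.T + 1)).map (Prod.mk S)) Set.univ = 1 := fun S => by
    rw [Measure.map_apply measurable_prodMk_left MeasurableSet.univ]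
    simp
  simp only [coinLaw, Measure.coe_finsetSum, Finset.sum_apply, Measure.smul_apply, h, smul_eq_mul,
    mul_one]
  rw [← ENNReal.ofReal_sum_of_nonneg fun S _ => restartWeight_nonneg h0 h1 S, sum_restartWeight,
    ENNReal.ofReal_one]

lemma integral_coinLaw {γ : ℝ} (h0 : 0 ≤ γ) (h1 : γ ≤ 1) {F : Finset ℕ × (ℕ → ℝ) → ℝ}
    (hF : Measurable F) {b : ℝ} (hb : ∀ ω, ‖F ω‖ ≤ b) :
    ∫ ω, F ω ∂(coinLaw P γ) = ∑ S ∈ (Finset.Icc 1 P.T).powerset,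
      restartWeight P γ S * ∫ u, F (S, u) ∂(Bandit.seedLaw (P.T + 1)) := by
  have hp : ∀ S : Finset ℕ, IsProbabilityMeasure ((Bandit.seedLaw (P.T + 1)).map (Prod.mk S)) :=
    fun S => Measure.isProbabilityMeasure_map measurable_prodMk_left.aemeasurable
  rw [coinLaw, integral_finsetSum_measure]
  · refine Finset.sum_congr rfl fun S _ => ?_
    rw [integral_smul_measure, integral_map measurable_prodMk_left.aemeasurable
      hF.aestronglyMeasurable, ENNReal.toReal_ofReal (restartWeight_nonneg h0 h1 S), smul_eq_mul]
  · intro S _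
    exact (Integrable.of_bound hF.aestronglyMeasurable b (ae_of_all _ hb)).smul_measure
      ENNReal.ofReal_ne_top

/-- Random restarts at rate `γ`, where EXP3 chooses the candidate in charge after each restart. -/
def banditRandomizedMechanism [NeZero n] {γ : ℝ} (h0 : 0 ≤ γ) (h1 : γ ≤ 1) (η : ℝ)
    (A : Fin n → Mechanism P) : RandomizedMechanism P where
  Ω := Finset ℕ × (ℕ → ℝ)
  mΩ := inferInstance
  μ := coinLaw P γ
  isProb := isProbabilityMeasure_coinLaw h0 h1
  -- The sample space contains all finite sets, so restarts are cut to the horizon; under `coinLaw`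
  -- this changes nothing almost surely.
  mech ω := banditMechanism η A (ω.1 ∩ Finset.Icc 1 P.T) Finset.inter_subset_right ω.2
  measurable_start k s := by
    have : {p : (Finset ℕ × (ℕ → ℝ)) × Instance | (banditMechanism η A (p.1.1 ∩ Finset.Icc 1 P.T)
        Finset.inter_subset_right p.1.2).start p.2 k = some s} =
        ⋃ S : Finset ℕ, (fun p => p.1.1) ⁻¹' {S} ∩ {p | composite A (S ∩ Finset.Icc 1 P.T)
          (blockArm η A (S ∩ Finset.Icc 1 P.T) p.1.2 p.2) p.2 k = some s} := by
      ext p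
      simp [banditMechanism]
    rw [this]
    refine MeasurableSet.iUnion fun S => ?_
    refine ((measurable_fst.comp measurable_fst) (measurableSet_singleton S)).inter ?_
    exact measurableSet_composite A _ (fun r => (measurable_blockArm η A _ r).comp
      ((measurable_snd.comp measurable_fst).prodMk measurable_snd)) measurable_snd k s

lemma expectedWelfare_nonneg (M : RandomizedMechanism P) {J : Instance} (hJ : J.Valid P) :
    0 ≤ M.expectedWelfare J :=
  integral_nonneg fun _ => welfare_nonneg _ hJ

lemma expectedWelfare_le (M : RandomizedMechanism P) {J : Instance} (hJ : J.Valid P) :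
    M.expectedWelfare J ≤ P.m * P.vmax * P.T := by
  let _ := M.mΩ
  have := M.isProb
  refine (integral_mono_of_nonneg (ae_of_all _ fun _ => welfare_nonneg _ hJ)
    (integrable_const (P.m * P.vmax * P.T : ℝ)) (ae_of_all _ fun ω => welfare_le _ hJ)).trans ?_
  simp

lemma expectedWelfare_banditRandomizedMechanism [NeZero n] {γ : ℝ} (h0 : 0 ≤ γ) (h1 : γ ≤ 1)
    (η : ℝ) (A : Fin n → Mechanism P) {J : Instance} (hJ : J.Valid P) :
    (banditRandomizedMechanism h0 h1 η A).expectedWelfare J =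
      ∑ S ∈ (Finset.Icc 1 P.T).powerset, restartWeight P γ S *
        ∫ u, ∑ r ∈ Finset.range (P.T + 1), blockWelfare (A (blockArm η A S u J r)) S J r
          ∂(Bandit.seedLaw (P.T + 1)) := by
  set F : Finset ℕ × (ℕ → ℝ) → ℝ := fun ω => welfare P ((banditMechanism η A
    (ω.1 ∩ Finset.Icc 1 P.T) Finset.inter_subset_right ω.2).start J) J with hF
  have hmeas : Measurable F := measurable_welfare P (fun k s =>
    (measurable_id.prodMk measurable_const)
      ((banditRandomizedMechanism h0 h1 η A).measurable_start k s)) measurable_const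
  have hb : ∀ ω, ‖F ω‖ ≤ P.m * P.vmax * P.T := fun ω => by
    rw [Real.norm_of_nonneg (welfare_nonneg _ hJ)]
    exact welfare_le _ hJ
  rw [show (banditRandomizedMechanism h0 h1 η A).expectedWelfare J =
    ∫ ω, F ω ∂(coinLaw P γ) from rfl, integral_coinLaw h0 h1 hmeas hb]
  refine Finset.sum_congr rfl fun S hS => ?_
  congr 1
  refine integral_congr_ae (ae_of_all _ fun u => ?_)
  have e : S ∩ Finset.Icc 1 P.T = S := Finset.inter_eq_left.2 (Finset.mem_powerset.1 hS)
  change welfare P (composite A (S ∩ Finset.Icc 1 P.T)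
    (blockArm η A (S ∩ Finset.Icc 1 P.T) u J) J) J = _
  rw [e, welfare_composite hJ]

/-- For fixed restarts, the bandit competes with every candidate. -/
lemma sum_blockWelfare_le [NeZero n] {η : ℝ} (hη : 0 < η) (A : Fin n → Mechanism P)
    {S : Finset ℕ} (hS : S ⊆ Finset.Icc 1 P.T) {J : Instance} (hJ : J.Valid P) (i : Fin n) :
    ∑ r ∈ Finset.range (P.T + 1), blockWelfare (A i) S J r ≤
      ∫ u, ∑ r ∈ Finset.range (P.T + 1), blockWelfare (A (blockArm η A S u J r)) S J r
          ∂(Bandit.seedLaw (P.T + 1)) + (Real.log n / η + η / 2 * n * (P.m * P.vmax) ^ 2 *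
        ∑ r ∈ Finset.range (P.T + 1), (blockLength P S r : ℝ) ^ 2) := by
  -- A positive `r` that is not a restart labels no time unit, so its bound and its loss vanish and
  -- EXP3 idles in that round.
  set B : ℕ → ℝ := fun r => P.m * P.vmax * blockLength P S r with hB
  have hl0 : ∀ r i, 0 ≤ blockLoss A S J r i := fun r i =>
    sub_nonneg.2 (blockWelfare_le (A i) hS hJ r)
  have hlB : ∀ r i, blockLoss A S J r i ≤ B r := fun r i =>
    sub_le_self _ (blockWelfare_nonneg (A i) S hJ r)
  have key := Bandit.integral_loss_le hη i (P.T + 1) (blockLoss A S J) B hl0 hlB 0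
  have hint := Bandit.integrable_sum_loss_arm η (P.T + 1) hl0 hlB 0 (Bandit.seedLaw (P.T + 1))
  have e : ∫ u, ∑ r ∈ Finset.range (P.T + 1), blockWelfare (A (blockArm η A S u J r)) S J r
      ∂(Bandit.seedLaw (P.T + 1)) = ∑ r ∈ Finset.range (P.T + 1), B r -
      ∫ u, ∑ r ∈ Finset.range (P.T + 1), blockLoss A S J r
        (Bandit.arm η (blockLoss A S J) 0 u r) ∂(Bandit.seedLaw (P.T + 1)) := by
    rw [show ∑ r ∈ Finset.range (P.T + 1), B r = ∫ _u : ℕ → ℝ, ∑ r ∈ Finset.range (P.T + 1), B r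
      ∂(Bandit.seedLaw (P.T + 1)) by simp, ← integral_sub (integrable_const _) hint]
    refine integral_congr_ae (ae_of_all _ fun u => ?_)
    simp only [← Finset.sum_sub_distrib]
    refine Finset.sum_congr rfl fun r _ => ?_
    rw [blockLoss, hB, sub_sub_cancel]
    rfl
  have e1 : ∑ r ∈ Finset.range (P.T + 1), blockLoss A S J r i =
      ∑ r ∈ Finset.range (P.T + 1), B r -
        ∑ r ∈ Finset.range (P.T + 1), blockWelfare (A i) S J r := by
    rw [← Finset.sum_sub_distrib]
    rfl
  have e2 : ∑ r ∈ Finset.range (P.T + 1), B r ^ 2 = (P.m * P.vmax) ^ 2 *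
      ∑ r ∈ Finset.range (P.T + 1), (blockLength P S r : ℝ) ^ 2 := by
    rw [Finset.mul_sum]
    exact Finset.sum_congr rfl fun r _ => mul_pow _ _ 2
  rw [e1, e2] at key
  simp only [Pi.zero_apply, mul_zero, neg_zero, Real.exp_zero, Finset.sum_const, Finset.card_univ,
    Fintype.card_fin, nsmul_eq_mul, mul_one, add_zero] at key
  rw [e]
  linarith

lemma restartWelfare_eq (γ : ℝ) (A : Mechanism P) {J : Instance} (hJ : J.Valid P) :
    restartWelfare γ A J = ∑ S ∈ (Finset.Icc 1 P.T).powerset, restartWeight P γ S *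
      ∑ r ∈ Finset.range (P.T + 1), blockWelfare A S J r := by
  refine Finset.sum_congr rfl fun S _ => ?_
  congr 1
  -- Restarting one mechanism is the composite with a single candidate.
  exact welfare_composite (A := fun _ : Fin 1 => A) (c := fun _ => 0) hJ

/-- The regret with respect to the random-restarting benchmark, on each instance. -/
lemma restartOPT_le_expectedWelfare_add [NeZero n] {γ : ℝ} (h0 : 0 < γ) (h1 : γ ≤ 1)
    (hL : γ * ((P.lmax : ℝ) + P.dmax) ≤ 1) {η : ℝ} (hη : 0 < η) (A : Fin n → Mechanism P)
    {J : Instance} (hJ : J.Valid P) :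
    restartOPT γ A J ≤ (banditRandomizedMechanism h0.le h1 η A).expectedWelfare J +
      (Real.log n / η + η / 2 * n * (P.m * P.vmax) ^ 2 * (3 * P.T / γ)) := by
  refine ciSup_le fun i => ?_
  rw [restartWelfare_eq γ (A i) hJ, expectedWelfare_banditRandomizedMechanism h0.le h1 η A hJ]
  refine (Finset.sum_le_sum fun S hS => mul_le_mul_of_nonneg_left
    (sum_blockWelfare_le hη A (Finset.mem_powerset.1 hS) hJ i)
    (restartWeight_nonneg h0.le h1 S)).trans ?_
  simp only [mul_add, Finset.sum_add_distrib, ← Finset.sum_mul, sum_restartWeight, one_mul]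
  gcongr
  have h := mul_le_mul_of_nonneg_left (expected_blockLength_sq_le P h0 h1 hL)
    (show 0 ≤ η / 2 * n * (P.m * P.vmax) ^ 2 by positivity)
  refine le_trans (le_of_eq ?_) h
  rw [Finset.mul_sum]
  exact Finset.sum_congr rfl fun S _ => mul_left_comm _ _ _

/-! ### Expectations over the instances -/

lemma integral_expectedWelfare_nonneg (M : RandomizedMechanism P) {D : Measure Instance}
    (hD : ∀ᵐ J ∂D, J.Valid P) : 0 ≤ ∫ J, M.expectedWelfare J ∂D :=
  integral_nonneg_of_ae (hD.mono fun _ hJ => expectedWelfare_nonneg M hJ)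

lemma integral_OPT_le [NeZero n] (A : Fin n → Mechanism P) {D : Measure Instance}
    [IsProbabilityMeasure D] (hD : ∀ᵐ J ∂D, J.Valid P) :
    ∫ J, OPT A J ∂D ≤ P.m * P.vmax * P.T := by
  refine (integral_mono_of_nonneg (hD.mono fun J hJ => ?_)
    (integrable_const (P.m * P.vmax * P.T : ℝ)) (hD.mono fun J hJ => ?_)).trans ?_
  · exact Real.iSup_nonneg fun i => welfare_nonneg _ hJ
  · exact ciSup_le fun i => welfare_le (A i) hJ
  · simp

lemma integral_OPT_sub_le {γ : ℝ} (A : Fin n → Mechanism P) (M : RandomizedMechanism P)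
    {D : Measure Instance} [IsProbabilityMeasure D] (hD : ∀ᵐ J ∂D, J.Valid P) {R : ℝ}
    (hR0 : 0 ≤ R) (hR : ∀ J : Instance, J.Valid P → restartOPT γ A J ≤ M.expectedWelfare J + R)
    (hrob : RobustToWelfareLoss γ A D) :
    (∫ J, OPT A J ∂D) - (∫ J, M.expectedWelfare J ∂D) ≤
      R + γ * P.T * (P.vmax * ((P.lmax : ℝ) + P.dmax)) := by
  have hint : Integrable (fun J => M.expectedWelfare J) D := by
    refine Integrable.of_bound M.measurable_expectedWelfare.aestronglyMeasurable
      (P.m * P.vmax * P.T : ℝ) (hD.mono fun J hJ => ?_)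
    rw [Real.norm_of_nonneg (expectedWelfare_nonneg M hJ)]
    exact expectedWelfare_le M hJ
  have h : ∫ J, restartOPT γ A J ∂D ≤ (∫ J, M.expectedWelfare J ∂D) + R := by
    by_cases hi : Integrable (fun J => restartOPT γ A J) D
    · refine (integral_mono_ae hi (hint.add (integrable_const R))
        (hD.mono fun J hJ => hR J hJ)).trans (le_of_eq ?_)
      simp only [Pi.add_apply]
      rw [integral_add hint (integrable_const R)]
      simp
    -- Without integrability the integral is 0 by convention, and the right side is nonnegative.
    · rw [integral_undef hi]
      exact add_nonneg (integral_expectedWelfare_nonneg M hD) hR0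
  unfold RobustToWelfareLoss at hrob
  linarith

/-- A deterministic mechanism as a randomized one. -/
def RandomizedMechanism.ofMechanism (A : Mechanism P) : RandomizedMechanism P where
  Ω := Unit
  mΩ := inferInstance
  μ := Measure.dirac ()
  isProb := inferInstance
  mech _ := A
  measurable_start k s := measurable_snd (A.measurable_start k s)

lemma expectedWelfare_ofMechanism (A : Mechanism P) (J : Instance) :
    (RandomizedMechanism.ofMechanism A).expectedWelfare J = welfare P (A.start J) J := by
  change ∫ _ω : Unit, welfare P (A.start J) J ∂(Measure.dirac ()) = _
  rw [integral_dirac]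

lemma OPT_of_unique (A : Fin 1 → Mechanism P) (J : Instance) :
    OPT A J = (RandomizedMechanism.ofMechanism (A 0)).expectedWelfare J := by
  rw [expectedWelfare_ofMechanism, OPT, ciSup_unique]
  rfl

lemma OPT_eq_zero_of_lmax_eq_zero [NeZero n] (hl : P.lmax = 0) (A : Fin n → Mechanism P)
    {J : Instance} (hJ : J.Valid P) : OPT A J = 0 := by
  have h : ∀ i, welfare P ((A i).start J) J = 0 := by
    intro i
    refine Finset.sum_eq_zero fun t _ => Finset.sum_eq_zero fun k hk => ?_
    obtain ⟨hk, s, -, h1, h2⟩ := mem_running.1 hk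
    have := hJ.length_le k hk
    omega
  simp [OPT, h]

/-! ### The choice of the parameters -/

lemma rpow_identity_loss {L T c : ℝ} (hL : 0 < L) (hT : 0 < T) :
    L ^ (-(2 / 3) : ℝ) * T ^ (-(1 / 3) : ℝ) * c ^ (1 / 3 : ℝ) * T * L =
      L ^ (1 / 3 : ℝ) * c ^ (1 / 3 : ℝ) * T ^ (2 / 3 : ℝ) := by
  have h1 : L ^ (1 / 3 : ℝ) = L ^ (-(2 / 3) : ℝ) * L := by
    rw [← Real.rpow_add_one hL.ne']; norm_num
  have h2 : T ^ (2 / 3 : ℝ) = T ^ (-(1 / 3) : ℝ) * T := by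
    rw [← Real.rpow_add_one hT.ne']; norm_num
  rw [h1, h2]; ring

/-- This is γX² = cT, which turns the variance term, proportional to cT / (γX), into a multiple of
X. -/
lemma rpow_identity_regret {L T c : ℝ} (hL : 0 < L) (hT : 0 < T) (hc : 0 < c) :
    L ^ (-(2 / 3) : ℝ) * T ^ (-(1 / 3) : ℝ) * c ^ (1 / 3 : ℝ) *
      (L ^ (1 / 3 : ℝ) * c ^ (1 / 3 : ℝ) * T ^ (2 / 3 : ℝ)) ^ 2 = c * T := by
  have h1 : L ^ (-(2 / 3) : ℝ) * (L ^ (1 / 3 : ℝ)) ^ 2 = 1 := by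
    rw [← Real.rpow_natCast, ← Real.rpow_mul hL.le, ← Real.rpow_add hL]; norm_num
  have h2 : T ^ (-(1 / 3) : ℝ) * (T ^ (2 / 3 : ℝ)) ^ 2 = T := by
    rw [← Real.rpow_natCast, ← Real.rpow_mul hT.le, ← Real.rpow_add hT]; norm_num
  have h3 : c ^ (1 / 3 : ℝ) * (c ^ (1 / 3 : ℝ)) ^ 2 = c := by
    rw [← pow_succ', ← Real.rpow_natCast, ← Real.rpow_mul hc.le]; norm_num
  calc _ = (L ^ (-(2 / 3) : ℝ) * (L ^ (1 / 3 : ℝ)) ^ 2) *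
        (T ^ (-(1 / 3) : ℝ) * (T ^ (2 / 3 : ℝ)) ^ 2) *
        (c ^ (1 / 3 : ℝ) * (c ^ (1 / 3 : ℝ)) ^ 2) := by ring
    _ = c * T := by rw [h1, h2, h3]; ring

/-- The regret of the bandit over random restarts when the benchmark is not trivial. -/
lemma exists_mechanism_regret_le [NeZero n] (A : Fin n → Mechanism P) (hn : 2 ≤ n) (hT : 0 < P.T)
    (hL : (1 : ℝ) ≤ (P.lmax : ℝ) + P.dmax) (hm : (1 : ℝ) ≤ P.m) (hv : 0 < P.vmax)
    (hX : ((P.lmax : ℝ) + P.dmax) ^ (1 / 3 : ℝ) * ((n : ℝ) * Real.log n) ^ (1 / 3 : ℝ) *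
      (P.T : ℝ) ^ (2 / 3 : ℝ) ≤ P.T) :
    ∃ M : RandomizedMechanism P, ∀ (D : Measure Instance) [IsProbabilityMeasure D],
      (∀ᵐ J ∂D, J.Valid P) → RobustToWelfareLoss (restartProb P n) A D →
      (∫ J, OPT A J ∂D) - (∫ J, M.expectedWelfare J ∂D) ≤
        7 / 2 * (P.m * P.vmax * (((P.lmax : ℝ) + P.dmax) ^ (1 / 3 : ℝ) *
          ((n : ℝ) * Real.log n) ^ (1 / 3 : ℝ) * (P.T : ℝ) ^ (2 / 3 : ℝ))) := by
  set L : ℝ := (P.lmax : ℝ) + P.dmax with hLdef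
  set T : ℝ := (P.T : ℝ) with hTdef
  have hT0 : 0 < T := Nat.cast_pos.2 hT
  have hL0 : 0 < L := one_pos.trans_le hL
  have hlog : 0 < Real.log n := Real.log_pos (by exact_mod_cast hn)
  have hn0 : (0 : ℝ) < n := by positivity
  set c : ℝ := (n : ℝ) * Real.log n with hc
  have hc0 : 0 < c := mul_pos hn0 hlog
  set X : ℝ := L ^ (1 / 3 : ℝ) * c ^ (1 / 3 : ℝ) * T ^ (2 / 3 : ℝ) with hXdef
  have hX0 : 0 < X := by positivity
  set γ : ℝ := L ^ (-(2 / 3) : ℝ) * T ^ (-(1 / 3) : ℝ) * c ^ (1 / 3 : ℝ) with hγdef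
  have hγ0 : 0 < γ := by positivity
  have hloss : γ * T * L = X := rpow_identity_loss hL0 hT0
  have hreg : γ * X ^ 2 = c * T := rpow_identity_regret hL0 hT0 hc0
  -- Since γLT = X ≤ T. With L ≥ 1 it also yields γ ≤ 1, so the cap in `restartProb` is inactive.
  have hγL : γ * L ≤ 1 := by
    have h : γ * L * T ≤ 1 * T := by rw [one_mul, mul_right_comm, hloss]; exact hX
    exact le_of_mul_le_mul_right h hT0
  have hγ1 : γ ≤ 1 := by nlinarith
  have hprob : restartProb P n = γ := min_eq_right hγ1
  set V : ℝ := P.m * P.vmax with hV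
  have hV0 : 0 < V := mul_pos (one_pos.trans_le hm) hv
  -- Chosen so that log n / η = VX; the variance term is then 3/2 · VX, for a total of 5/2 · VX.
  set η : ℝ := Real.log n / (X * V) with hη
  have hη0 : 0 < η := by positivity
  have hR : Real.log n / η + η / 2 * n * V ^ 2 * (3 * T / γ) = 5 / 2 * (V * X) := by
    have e1 : Real.log n / η = V * X := by rw [hη]; field_simp
    have e2 : η / 2 * n * V ^ 2 * (3 * T / γ) = 3 / 2 * V * (c * T) / (X * γ) := by
      rw [hη, hc]; field_simp
    rw [e1, e2, ← hreg]
    field_simp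
    norm_num
  refine ⟨banditRandomizedMechanism hγ0.le hγ1 η A, fun D _ hD hrob => ?_⟩
  rw [hprob] at hrob
  have h := integral_OPT_sub_le A _ hD (R := 5 / 2 * (V * X)) (by positivity)
    (fun J hJ => (restartOPT_le_expectedWelfare_add hγ0 hγ1 hγL hη0 A hJ).trans
      (by rw [hR])) hrob
  refine h.trans ?_
  have h2 : γ * T * (P.vmax * L) = P.vmax * X := by rw [← hloss]; ring
  -- The restart loss carries no factor `m`; m ≥ 1 lets it be absorbed, raising 5/2 to 7/2.
  have h3 : P.vmax * X ≤ V * X :=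
    mul_le_mul_of_nonneg_right (le_mul_of_one_le_left hv.le hm) hX0.le
  linarith

end Scheduling

end

/-! ### The main theorem and its degenerate cases. -/

theorem mainTheorem8 :
    ∃ C : ℝ, 0 < C ∧
      ∀ (P : Scheduling.Params) (n : ℕ) (A : Fin n → Scheduling.Mechanism P),
        2 ≤ P.T → 1 ≤ n →
        ∃ M : Scheduling.RandomizedMechanism P,
          ∀ (D : Measure Scheduling.Instance) [IsProbabilityMeasure D],
            (∀ᵐ J ∂D, J.Valid P) →
            Scheduling.RobustToWelfareLoss (Scheduling.restartProb P n) A D →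
            (∫ J, Scheduling.OPT A J ∂D) - (∫ J, M.expectedWelfare J ∂D) ≤
              C * ((P.m : ℝ) * P.vmax * ((P.lmax : ℝ) + (P.dmax : ℝ)) ^ (1 / 3 : ℝ) *
                ((n : ℝ) * Real.log n) ^ (1 / 3 : ℝ) *
                (P.T : ℝ) ^ (2 / 3 : ℝ) * Real.log P.T) := by
  -- The constant 6 works because 7/2 ≤ 6 log 2 ≤ 6 log T.
  refine ⟨6, by norm_num, fun P n A hT hn => ?_⟩
  have : NeZero n := ⟨by omega⟩
  have hvm := P.vmax_nonneg
  have hlogT : Real.log 2 ≤ Real.log P.T :=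
    Real.log_le_log (by norm_num) (by exact_mod_cast hT)
  have hlog2 := Real.log_two_gt_d9
  have hlogn : 0 ≤ Real.log n := Real.log_natCast_nonneg n
  set X : ℝ := ((P.lmax : ℝ) + (P.dmax : ℝ)) ^ (1 / 3 : ℝ) *
    ((n : ℝ) * Real.log n) ^ (1 / 3 : ℝ) * (P.T : ℝ) ^ (2 / 3 : ℝ) with hX
  have hX0 : 0 ≤ X := by positivity
  have hV0 : 0 ≤ P.m * P.vmax := by positivity
  have hbound : 6 * ((P.m : ℝ) * P.vmax * ((P.lmax : ℝ) + (P.dmax : ℝ)) ^ (1 / 3 : ℝ) *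
      ((n : ℝ) * Real.log n) ^ (1 / 3 : ℝ) * (P.T : ℝ) ^ (2 / 3 : ℝ) * Real.log P.T) =
      6 * Real.log P.T * (P.m * P.vmax * X) := by rw [hX]; ring
  have hlower : 7 / 2 * (P.m * P.vmax * X) ≤ 6 * Real.log P.T * (P.m * P.vmax * X) :=
    mul_le_mul_of_nonneg_right (by linarith) (by positivity)
  simp only [hbound]
  -- All case distinctions involve only `P` and `n`, so the mechanism is fixed before `D`. Here the
  -- total welfare is already below the bound; the failure of this case later yields X ≤ T, m ≥ 1
  -- and vmax > 0.
  by_cases hsmall : (P.m * P.vmax * P.T : ℝ) ≤ 7 / 2 * (P.m * P.vmax * X)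
  · refine ⟨.ofMechanism (A 0), fun D _ hD _ => ?_⟩
    have h1 := Scheduling.integral_OPT_le A hD
    have h2 := Scheduling.integral_expectedWelfare_nonneg (.ofMechanism (A 0)) hD
    linarith
  rw [not_le] at hsmall
  -- A single candidate is run as it is, with zero regret; EXP3 is avoided because log 1 = 0 would
  -- make η vanish.
  rcases Nat.eq_or_lt_of_le hn with rfl | hn2
  · refine ⟨.ofMechanism (A 0), fun D _ hD _ => ?_⟩
    simp only [Scheduling.OPT_of_unique, sub_self]
    exact le_trans (by positivity) hlower
  rcases Nat.eq_zero_or_pos (P.lmax + P.dmax) with hL | hL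
  · refine ⟨.ofMechanism (A 0), fun D _ hD _ => ?_⟩
    have h1 : ∫ J, Scheduling.OPT A J ∂D = 0 := by
      refine integral_eq_zero_of_ae (hD.mono fun J hJ => ?_)
      exact Scheduling.OPT_eq_zero_of_lmax_eq_zero (by omega) A hJ
    have h2 := Scheduling.integral_expectedWelfare_nonneg (.ofMechanism (A 0)) hD
    have h3 : 0 ≤ 7 / 2 * (P.m * P.vmax * X) := by positivity
    linarith
  have hVpos : 0 < P.m * P.vmax := by
    refine hV0.lt_of_ne fun h => ?_
    rw [← h] at hsmall
    simp at hsmall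
  have hXT : X ≤ P.T := by
    by_contra hcon
    have := mul_le_mul_of_nonneg_left (not_le.1 hcon).le hV0
    have : 0 ≤ P.m * P.vmax * X := by positivity
    linarith
  have hm : (1 : ℝ) ≤ P.m := by
    have : P.m ≠ 0 := fun h => by simp [h] at hVpos
    exact_mod_cast Nat.one_le_iff_ne_zero.2 this
  have hv : 0 < P.vmax := pos_of_mul_pos_right hVpos (Nat.cast_nonneg _)
  obtain ⟨M, hM⟩ := Scheduling.exists_mechanism_regret_le A hn2 (by omega)
    (by exact_mod_cast hL) hm hv hXT
  exact ⟨M, fun D _ hD hrob => (hM D hD hrob).trans hlower⟩
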